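/- Let $N\ge 1$ be an integer. The differential polynomials $L_k[u]$ are given by $L_0[u]=\tfrac12$ and the Lenard recursion $\frac{d}{dz}L_{k+1}[u]=\bigl(\frac{d^3}{dz^3}+4u\frac{d}{dz}+2u_z\bigr)L_k[u]$, the constants of integration being chosen so that $L_k[0]=0$ for $k\ge 1$. The $N$-th equation of the second Painlevé hierarchy is $$P_2^{(N)}[w,\alpha]:\quad \Bigl(\frac{d}{dz}+2w\Bigr)L_N[w'-w^2]-zw-\alpha=0 .$$ There is exactly one sequence $(Q_n^{(N)})_{n\ge 0}$ of monic polynomials in $\mathbb{C}[z]$ with $Q_0^{(N)}=1$, $Q_1^{(N)}=z$ such that for every $n\ge 1$ the rational function $w(z)=\frac{d}{dz}\ln\frac{Q_{n-1}^{(N)}(z)}{Q_n^{(N)}(z)}$ solves $P_2^{(N)}[w,n]$ (the generalized Yablonskii--Vorob'ev polynomials). Write $Q_n^{(N)}(z)=\sum_{k=0}^{p_n}A_{n,k}^{(N)}z^{p_n-k}$ with $p_n=\deg Q_n^{(N)}$. For every integer $l\ge 0$, the coefficient $A_{n,(2N+1)l}^{(N)}$ is a polynomial in $n$ of degree $2(N+1)l$: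 there is a polynomial $P\in\mathbb{C}[x]$ of degree $2(N+1)l$ with $A_{n,(2N+1)l}^{(N)}=P(n)$ for all $n\ge 0$ with $(2N+1)l\le p_n$. Moreover, $P(x)$ is divisible in $\mathbb{C}[x]$ by $x(x-1)\cdots(x-n_0+1)$, where $n_0=\Bigl\lceil\sqrt{\tfrac14+2(2N+1)l}-\tfrac12\Bigr\rceil$. -/

import Mathlib

open Polynomial

namespace PainleveII

/-- The derivative `d/dz` on the field `ℂ(z)` of rational functions. -/
noncomputable def ratDerivFun (f : RatFunc ℂ) : RatFunc ℂ :=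
  (algebraMap ℂ[X] (RatFunc ℂ) (derivative f.num) * algebraMap ℂ[X] (RatFunc ℂ) f.denom
    - algebraMap ℂ[X] (RatFunc ℂ) f.num * algebraMap ℂ[X] (RatFunc ℂ) (derivative f.denom))
    / algebraMap ℂ[X] (RatFunc ℂ) f.denom ^ 2

theorem quotient_rule_aux {K : Type*} [Field K] {a b a' b' p q p' q' : K} (hb : b ≠ 0)
    (hq : q ≠ 0) (h : a * q = p * b) (h' : a' * q + a * q' = p' * b + p * b') :
    (a' * b - a * b') / b ^ 2 = (p' * q - p * q') / q ^ 2 := by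
  rw [div_eq_div_iff (pow_ne_zero 2 hb) (pow_ne_zero 2 hq)]
  linear_combination (b * q) * h' - (q * b' + b * q') * h

/-- The quotient rule, for every representation of a rational function as a fraction. -/
theorem ratDerivFun_div (p q : ℂ[X]) (hq : q ≠ 0) (f : RatFunc ℂ)
    (hf : f = algebraMap ℂ[X] (RatFunc ℂ) p / algebraMap ℂ[X] (RatFunc ℂ) q) :
    ratDerivFun f =
      (algebraMap ℂ[X] (RatFunc ℂ) (derivative p) * algebraMap ℂ[X] (RatFunc ℂ) q
        - algebraMap ℂ[X] (RatFunc ℂ) p * algebraMap ℂ[X] (RatFunc ℂ) (derivative q))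
        / algebraMap ℂ[X] (RatFunc ℂ) q ^ 2 := by
  have hd' : algebraMap ℂ[X] (RatFunc ℂ) f.denom ≠ 0 :=
    RatFunc.algebraMap_ne_zero (RatFunc.denom_ne_zero f)
  have hq' : algebraMap ℂ[X] (RatFunc ℂ) q ≠ 0 := RatFunc.algebraMap_ne_zero hq
  have key : f.num * q = p * f.denom := by
    apply RatFunc.algebraMap_injective ℂ
    rw [map_mul, map_mul]
    have h1 := hf
    rw [← RatFunc.num_div_denom f] at h1
    rwa [div_eq_div_iff hd' hq'] at h1
  have key' := congrArg derivative key
  rw [derivative_mul, derivative_mul] at key'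
  refine quotient_rule_aux hd' hq' ?_ ?_
  · rw [← map_mul, ← map_mul, key]
  · rw [← map_mul, ← map_mul, ← map_mul, ← map_mul, ← map_add, ← map_add, key']

theorem add_rule_aux {K : Type*} [Field K] {a b a' b' p q p' q' : K} (hb : b ≠ 0)
    (hq : q ≠ 0) :
    ((a' * q + a * q' + (b' * p + b * p')) * (b * q) - (a * q + b * p) * (b' * q + b * q'))
      / (b * q) ^ 2 = (a' * b - a * b') / b ^ 2 + (p' * q - p * q') / q ^ 2 := by
  field_simp
  ring

theorem mul_rule_aux {K : Type*} [Field K] {a b a' b' p q p' q' : K} (hb : b ≠ 0)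
    (hq : q ≠ 0) :
    ((a' * p + a * p') * (b * q) - (a * p) * (b' * q + b * q'))
      / (b * q) ^ 2 = a / b * ((p' * q - p * q') / q ^ 2) + p / q * ((a' * b - a * b') / b ^ 2) := by
  field_simp
  ring

/-- `d/dz` as a derivation of `ℂ(z)` over `ℂ`. -/
noncomputable def ratDeriv : Derivation ℂ (RatFunc ℂ) (RatFunc ℂ) :=
  Derivation.mk'
    { toFun := ratDerivFun
      map_add' := by
        intro f g
        have hf : algebraMap ℂ[X] (RatFunc ℂ) f.denom ≠ 0 :=
          RatFunc.algebraMap_ne_zero (RatFunc.denom_ne_zero f)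
        have hg : algebraMap ℂ[X] (RatFunc ℂ) g.denom ≠ 0 :=
          RatFunc.algebraMap_ne_zero (RatFunc.denom_ne_zero g)
        have h : f + g = algebraMap ℂ[X] (RatFunc ℂ) (f.num * g.denom + f.denom * g.num) /
            algebraMap ℂ[X] (RatFunc ℂ) (f.denom * g.denom) := by
          conv_lhs => rw [← RatFunc.num_div_denom f, ← RatFunc.num_div_denom g]
          rw [div_add_div _ _ hf hg]
          simp only [map_add, map_mul]
        rw [ratDerivFun_div _ _ (mul_ne_zero (RatFunc.denom_ne_zero f)
          (RatFunc.denom_ne_zero g)) _ h]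
        simp only [derivative_mul, map_add, map_mul]
        exact add_rule_aux hf hg
      map_smul' := by
        intro c f
        have hf : algebraMap ℂ[X] (RatFunc ℂ) f.denom ≠ 0 :=
          RatFunc.algebraMap_ne_zero (RatFunc.denom_ne_zero f)
        have h : c • f = algebraMap ℂ[X] (RatFunc ℂ) (C c * f.num) /
            algebraMap ℂ[X] (RatFunc ℂ) f.denom := by
          conv_lhs => rw [← RatFunc.num_div_denom f]
          rw [map_mul, RatFunc.algebraMap_C, RatFunc.smul_eq_C_mul, mul_div_assoc]
        rw [ratDerivFun_div _ _ (RatFunc.denom_ne_zero f) _ h]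
        unfold ratDerivFun
        simp only [derivative_mul, derivative_C, zero_mul, zero_add, map_mul,
          RatFunc.algebraMap_C, RingHom.id_apply, RatFunc.smul_eq_C_mul]
        ring }
    (by
      intro f g
      have hf : algebraMap ℂ[X] (RatFunc ℂ) f.denom ≠ 0 :=
        RatFunc.algebraMap_ne_zero (RatFunc.denom_ne_zero f)
      have hg : algebraMap ℂ[X] (RatFunc ℂ) g.denom ≠ 0 :=
        RatFunc.algebraMap_ne_zero (RatFunc.denom_ne_zero g)
      have h : f * g = algebraMap ℂ[X] (RatFunc ℂ) (f.num * g.num) /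
          algebraMap ℂ[X] (RatFunc ℂ) (f.denom * g.denom) := by
        conv_lhs => rw [← RatFunc.num_div_denom f, ← RatFunc.num_div_denom g]
        rw [div_mul_div_comm]
        simp only [map_mul]
      change ratDerivFun (f * g) = f • ratDerivFun g + g • ratDerivFun f
      rw [ratDerivFun_div _ _ (mul_ne_zero (RatFunc.denom_ne_zero f)
          (RatFunc.denom_ne_zero g)) _ h]
      simp only [derivative_mul, map_add, map_mul, smul_eq_mul]
      refine (mul_rule_aux hf hg).trans ?_
      rw [RatFunc.num_div_denom, RatFunc.num_div_denom]
      rfl)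

theorem ratDeriv_algebraMap (p : ℂ[X]) :
    ratDeriv (algebraMap ℂ[X] (RatFunc ℂ) p) = algebraMap ℂ[X] (RatFunc ℂ) (derivative p) := by
  have h := ratDerivFun_div p 1 one_ne_zero (algebraMap ℂ[X] (RatFunc ℂ) p) (by simp)
  simp only [map_one, div_one, derivative_one, map_zero, mul_zero, sub_zero, mul_one,
    one_pow] at h
  exact h

section Lenard

variable {R : Type*} [CommRing R] [Algebra ℂ R] (d : Derivation ℂ R R)

/-- The Lenard differential polynomials `L_k[u]`, evaluated at an element `u` of a commutative
`ℂ`-algebra with a derivation `d`: `L_0 = 1/2`, `L_1 = u`, `L_2 = u'' + 3u²`, ...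
The recursion below needs no integration; `lenard_recursion` proves the Lenard relation
`(L_{k+1})' = L_k''' + 4 u L_k' + 2 u' L_k`, and `lenard_succ_zero` that the constants of
integration are the usual ones (`L_k` has no constant term for `k ≥ 1`). -/
noncomputable def lenard (u : R) : ℕ → R
  | 0 => algebraMap ℂ R (1 / 2)
  | k + 1 =>
      (∑ i : Fin (k + 1),
        (2 * lenard u i * d (d (lenard u (k - i))) - d (lenard u i) * d (lenard u (k - i))
          + 4 * u * lenard u i * lenard u (k - i)))
      - ∑ i : Fin k, lenard u (i + 1) * lenard u (k - i)
  termination_by k => k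
  decreasing_by all_goals omega

theorem lenard_zero (u : R) : lenard d u 0 = algebraMap ℂ R (1 / 2) := by
  rw [lenard]

/-- The quadratic relation behind the recursion. -/
theorem lenard_quadratic (u : R) (k : ℕ) :
    ∑ p ∈ Finset.HasAntidiagonal.antidiagonal (k + 1), lenard d u p.1 * lenard d u p.2 =
      ∑ p ∈ Finset.HasAntidiagonal.antidiagonal k, (2 * lenard d u p.1 * d (d (lenard d u p.2))
        - d (lenard d u p.1) * d (lenard d u p.2) + 4 * u * lenard d u p.1 * lenard d u p.2) := by
  have h2 : (2 : R) * algebraMap ℂ R (1 / 2) = 1 := by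
    rw [← map_ofNat (algebraMap ℂ R) 2, ← map_mul]; norm_num
  have e := lenard.eq_2 d u k
  rw [Fin.sum_univ_eq_sum_range (fun i => 2 * lenard d u i * d (d (lenard d u (k - i)))
        - d (lenard d u i) * d (lenard d u (k - i))
          + 4 * u * lenard d u i * lenard d u (k - i)),
    Fin.sum_univ_eq_sum_range (fun i => lenard d u (i + 1) * lenard d u (k - i))] at e
  rw [Finset.Nat.sum_antidiagonal_eq_sum_range_succ_mk,
    Finset.Nat.sum_antidiagonal_eq_sum_range_succ_mk, Finset.sum_range_succ,
    Finset.sum_range_succ']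
  simp only [Nat.sub_self, Nat.sub_zero, lenard_zero, Nat.add_sub_add_right]
  linear_combination e + lenard d u (k + 1) * h2

/-- The Lenard recursion relation. -/
theorem lenard_recursion (u : R) (k : ℕ) :
    d (lenard d u (k + 1)) =
      d (d (d (lenard d u k))) + 4 * u * d (lenard d u k) + 2 * d u * lenard d u k := by
  have h2 : (2 : R) * algebraMap ℂ R (1 / 2) = 1 := by
    rw [← map_ofNat (algebraMap ℂ R) 2, ← map_mul]; norm_num
  have d2 : d (2 : R) = 0 := by exact_mod_cast d.map_natCast 2
  have d4 : d (4 : R) = 0 := by exact_mod_cast d.map_natCast 4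
  have d0 : d (lenard d u 0) = 0 := by rw [lenard_zero]; exact d.map_algebraMap _
  set a := lenard d u with ha
  set D : ℕ → R := fun j => d (a (j + 1)) -
    (d (d (d (a j))) + 4 * u * d (a j) + 2 * d u * a j) with hD
  have hsum : ∀ k, ∑ p ∈ Finset.HasAntidiagonal.antidiagonal k, a p.1 * D p.2 = 0 := by
    intro k
    have q := congrArg d (lenard_quadratic d u k)
    rw [map_sum, map_sum, ← ha] at q
    simp only [Derivation.map_add, Derivation.map_sub, Derivation.leibniz, smul_eq_mul,
      d2, d4] at q
    have s1 : ∑ p ∈ Finset.HasAntidiagonal.antidiagonal (k + 1), (a p.1 * d (a p.2) + a p.2 * d (a p.1)) =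
        2 * ∑ p ∈ Finset.HasAntidiagonal.antidiagonal k, a p.1 * d (a (p.2 + 1)) := by
      rw [Finset.sum_add_distrib,
        ← Finset.Nat.sum_antidiagonal_swap (f := fun p : ℕ × ℕ => a p.2 * d (a p.1))]
      simp only [Prod.fst_swap, Prod.snd_swap]
      rw [Finset.Nat.sum_antidiagonal_succ' (f := fun p : ℕ × ℕ => a p.1 * d (a p.2)), d0]
      ring
    have sw : ∀ f : ℕ × ℕ → R, ∑ p ∈ Finset.HasAntidiagonal.antidiagonal k, f p.swap =
        ∑ p ∈ Finset.HasAntidiagonal.antidiagonal k, f p := fun f => Finset.Nat.sum_antidiagonal_swap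
    have t1 := sw (fun p => d (a p.1) * d (d (a p.2)))
    have t2 := sw (fun p => u * a p.1 * d (a p.2))
    simp only [Prod.fst_swap, Prod.snd_swap] at t1 t2
    rw [s1] at q
    have q2 : 2 * ∑ p ∈ Finset.HasAntidiagonal.antidiagonal k, a p.1 * D p.2 = 0 := by
      have e : ∀ p : ℕ × ℕ, a p.1 * D p.2 = a p.1 * d (a (p.2 + 1)) -
        (a p.1 * d (d (d (a p.2))) + 4 * (u * a p.1 * d (a p.2)) + 2 * (d u * a p.1 * a p.2)) := by
        intro p; simp only [hD]; ring
      simp only [e]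
      rw [Finset.sum_sub_distrib, mul_sub, q, sub_eq_zero]
      rw [← sub_eq_zero] at t1 t2 ⊢
      rw [← Finset.sum_sub_distrib] at t1 t2
      rw [Finset.mul_sum, ← Finset.sum_sub_distrib]
      refine Eq.trans ?_ (congrArg₂ (fun x y => (-1) * x + 4 * y) t1 t2 |>.trans (by simp))
      rw [Finset.mul_sum, Finset.mul_sum, ← Finset.sum_add_distrib]
      exact Finset.sum_congr rfl fun p _ => by ring
    calc _ = algebraMap ℂ R (1 / 2) * (2 * ∑ p ∈ Finset.HasAntidiagonal.antidiagonal k, a p.1 * D p.2) := by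
          rw [← mul_assoc, mul_comm _ (2 : R), h2, one_mul]
      _ = 0 := by rw [q2, mul_zero]
  have hD0 : ∀ k, D k = 0 := by
    intro k
    induction k using Nat.strong_induction_on with
    | _ k ih =>
      have h := hsum k
      rw [Finset.Nat.sum_antidiagonal_eq_sum_range_succ_mk, Finset.sum_range_succ'] at h
      rw [Finset.sum_eq_zero (fun i hi => by
        rw [Finset.mem_range] at hi
        simp only [ih (k - (i + 1)) (by omega), mul_zero])] at h
      simp only [Nat.sub_zero, zero_add] at h
      have h0 : a 0 = algebraMap ℂ R (1 / 2) := lenard_zero d u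
      rw [h0] at h
      linear_combination 2 * h - D k * h2
  exact sub_eq_zero.mp (hD0 k)

/-- The normalization of the constants of integration. -/
theorem lenard_succ_zero (k : ℕ) : lenard d (0 : R) (k + 1) = 0 := by
  induction k using Nat.strong_induction_on with
  | _ k ih =>
    have hd : ∀ j, j ≤ k → d (lenard d (0 : R) j) = 0 := by
      intro j hj
      cases j with
      | zero => rw [lenard_zero]; exact d.map_algebraMap _
      | succ j => rw [ih j (by omega), map_zero]
    rw [lenard]
    rw [Finset.sum_eq_zero, Finset.sum_eq_zero, sub_zero]
    · intro i _
      rw [ih i i.2, zero_mul]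
    · intro i _
      rw [hd (k - i) (by omega), map_zero]
      simp

theorem lenard_one (u : R) : lenard d u 1 = u := by
  have h2 : (2 : R) * algebraMap ℂ R (1 / 2) = 1 := by
    rw [← map_ofNat (algebraMap ℂ R) 2, ← map_mul]; norm_num
  rw [lenard, Fin.sum_univ_one, Fin.sum_univ_zero]
  simp only [Fin.val_zero, Nat.sub_zero, lenard_zero, Derivation.map_algebraMap, map_zero]
  linear_combination (2 * u * algebraMap ℂ R (1 / 2) + u) * h2

end Lenard

/-- The left-hand side of the `N`-th equation of the second Painlevé hierarchy,
`(d/dz + 2w) L_N[w' - w²] - z w - α`, for a rational function `w` of `z`. -/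
noncomputable def painleveII (N : ℕ) (w : RatFunc ℂ) (α : ℂ) : RatFunc ℂ :=
  ratDeriv (lenard ratDeriv (ratDeriv w - w ^ 2) N)
    + 2 * w * lenard ratDeriv (ratDeriv w - w ^ 2) N
    - RatFunc.X * w - RatFunc.C α

/-- The logarithmic derivative `d/dz ln (P / Q)` of a quotient of two polynomials. -/
noncomputable def logDerivQuot (P Q : ℂ[X]) : RatFunc ℂ :=
  ratDeriv (algebraMap ℂ[X] (RatFunc ℂ) P / algebraMap ℂ[X] (RatFunc ℂ) Q)
    / (algebraMap ℂ[X] (RatFunc ℂ) P / algebraMap ℂ[X] (RatFunc ℂ) Q)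

/-- `Q 0, Q 1, Q 2, ...` are the (generalized) Yablonskii–Vorob'ev polynomials of the `N`-th
equation: monic polynomials with `Q 0 = 1`, `Q 1 = z`, such that for every `n ≥ 1` the function
`w(z; n) = d/dz ln (Q_{n-1} / Q_n)` solves the `N`-th equation with parameter `α = n`. -/
structure IsYablonskiiVorobev (N : ℕ) (Q : ℕ → ℂ[X]) : Prop where
  monic : ∀ n, (Q n).Monic
  zero : Q 0 = 1
  one : Q 1 = X
  solution : ∀ n, 1 ≤ n → painleveII N (logDerivQuot (Q (n - 1)) (Q n)) (n : ℂ) = 0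

/-- The coefficient `A_{k}` of `Q = ∑_{k=0}^{p} A_k z^{p-k}`, `p = deg Q`, where `0 ≤ k ≤ p`. -/
noncomputable def coeffA (Q : ℂ[X]) (k : ℕ) : ℂ := Q.coeff (Q.natDegree - k)

/-- `n_0 = ⌈√(1/4 + 2(2N+1)l) - 1/2⌉`, a nonnegative integer. -/
noncomputable def nZero (N l : ℕ) : ℕ :=
  ⌈Real.sqrt (1 / 4 + 2 * (2 * N + 1) * l) - 1 / 2⌉₊

/-- `T(n) = n (n - 1) ⋯ (n - (m - 1))`, as a polynomial in `n`. -/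
noncomputable def polyT (m : ℕ) : ℂ[X] := ∏ i ∈ Finset.range m, (X - C (i : ℂ))

end PainleveII

/-!
Existence: for `w = ψ' / ψ` with `ψ = Q_{n-1} / Q_n`, define `φ` by `φ ψ = z - 2 L_N[-ψ'' / ψ]`.
The expression `(d/dz + 2w) L_N[w' - w²]` is odd in `w`, because a Darboux transformation takes
`∑ L_k[w' - w²] λ^k` to `∑ L_k[-w' - w²] λ^k`. Hence `φ` has constant Wronskian `2n + 1` with `ψ`,
satisfies `φ'' / φ = ψ'' / ψ`, and `-φ' / φ` solves the equation with parameter `n + 1`. The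
multiplicities `a`, `b` of a point as a root of `Q_{n-1}` and `Q_n` satisfy `(a - b)² = a + b`, and
this is what excludes poles of `φ Q_n`, so that `φ = Q_{n+1} / Q_n`.

At infinity, `w = z⁻¹ ((d/dz + 2w) L_N[w' - w²] - α)` is a fixed point equation for a contraction.
Its solution is therefore unique, and its expansion in `1/z` has coefficients polynomial in `α`.
Summing `-z w(z; i)` over `1 ≤ i ≤ n` gives `z Q_n' / Q_n`, so the power sums `s_k` of the roots of
`Q_n` are polynomials in `n`, and so are the coefficients of `Q_n` by Newton's identities. For
`k ≠ 0` the ratio `deg s_k / k` is at most `(2N + 2) / (2N + 1)`, with equality only at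
`k = 2N + 1`; hence `s_{2N+1}^l` alone determines the degree of the coefficient number
`(2N + 1) l`. Finally `deg Q_n = n (n + 1) / 2` is less than `(2N + 1) l` for `n < n_0`, which makes
that polynomial vanish at `0, …, n_0 - 1`.
-/

namespace PainleveII

section DifferentialAlgebra

variable {R : Type*} [CommRing R] [Algebra ℂ R] (d : Derivation ℂ R R)

/-- The stationary modified KdV hierarchy: the differential polynomial `(d + 2w) L_N[w' - w²]` in an
element `w` of a differential algebra. -/
noncomputable def mkdv (N : ℕ) (w : R) : R :=
  d (lenard d (d w - w ^ 2) N) + 2 * w * lenard d (d w - w ^ 2) N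

theorem map_lenard {R' : Type*} [CommRing R'] [Algebra ℂ R'] {d : Derivation ℂ R R}
    {d' : Derivation ℂ R' R'} {f : R →ₐ[ℂ] R'} (hf : ∀ a, f (d a) = d' (f a)) (u : R) (k : ℕ) :
    f (lenard d u k) = lenard d' (f u) k := by
  induction k using Nat.strong_induction_on with
  | _ k ih =>
    cases k with
    | zero => simp only [lenard_zero, AlgHom.commutes]
    | succ k =>
      rw [lenard, lenard]
      simp only [map_sub, map_sum, map_add, map_mul, map_ofNat, hf]
      have hlt : ∀ j ≤ k, f (lenard d u j) = lenard d' (f u) j := fun j hj => ih j (by lia)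
      congr 1
      · refine Finset.sum_congr rfl fun i _ => ?_
        rw [hlt i (by lia), hlt (k - i) (by lia)]
      · refine Finset.sum_congr rfl fun i _ => ?_
        rw [hlt (i + 1) (by lia), hlt (k - i) (by lia)]

theorem map_mkdv {R' : Type*} [CommRing R'] [Algebra ℂ R'] {d : Derivation ℂ R R}
    {d' : Derivation ℂ R' R'} {f : R →ₐ[ℂ] R'} (hf : ∀ a, f (d a) = d' (f a)) (N : ℕ) (w : R) :
    f (mkdv d N w) = mkdv d' N (f w) := by
  simp only [mkdv, map_add, map_mul, map_ofNat, hf, map_lenard hf, map_sub, map_pow]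

section Filtration

variable {d} {Φ : ℕ → Submodule ℂ R} [SetLike.GradedMonoid Φ]

theorem lenard_mem (hd : ∀ ⦃i a⦄, a ∈ Φ i → d a ∈ Φ (i + 1)) {u : R} (hu : u ∈ Φ 2) (k : ℕ) :
    lenard d u k ∈ Φ (2 * k) := by
  induction k using Nat.strong_induction_on with
  | _ k ih =>
    cases k with
    | zero => rw [lenard_zero]; exact SetLike.algebraMap_mem_graded Φ _
    | succ k =>
      have mul_mem {i j m : ℕ} {a b : R} (ha : a ∈ Φ i) (hb : b ∈ Φ j) (h : i + j = m) :
          a * b ∈ Φ m := h ▸ SetLike.mul_mem_graded ha hb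
      have natCast_mem (n : ℕ) : (n : R) ∈ Φ 0 := SetLike.natCast_mem_graded Φ n
      rw [lenard]
      refine sub_mem (sum_mem fun i _ => ?_) (sum_mem fun i _ => ?_)
      · have hi := ih i i.2
        have hj := ih (k - i) (by lia)
        refine add_mem (sub_mem ?_ ?_) ?_
        · exact mul_mem (mul_mem (natCast_mem 2) hi rfl) (hd (hd hj)) (by lia)
        · exact mul_mem (hd hi) (hd hj) (by lia)
        · exact mul_mem (mul_mem (mul_mem (natCast_mem 4) hu rfl) hi rfl) hj (by lia)
      · exact mul_mem (ih (i + 1) (by lia)) (ih (k - i) (by lia)) (by lia)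

theorem mkdv_mem (hd : ∀ ⦃i a⦄, a ∈ Φ i → d a ∈ Φ (i + 1)) {w : R} (hw : w ∈ Φ 1) (N : ℕ) :
    mkdv d N w ∈ Φ (2 * N + 1) := by
  have hu : d w - w ^ 2 ∈ Φ 2 := sub_mem (hd hw) (SetLike.pow_mem_graded 2 hw)
  have hL := lenard_mem hd hu N
  have h2w : 2 * w ∈ Φ 1 := by rw [two_mul]; exact add_mem hw hw
  exact add_mem (hd hL) (add_comm 1 (2 * N) ▸ SetLike.mul_mem_graded h2w hL)

end Filtration

section Difference

/-- The derivation `(a, b) ↦ (a', b')` of `R × R`. -/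
def prodDeriv : Derivation ℂ (R × R) (R × R) :=
  Derivation.mk' ((d : R →ₗ[ℂ] R).prodMap d) fun a b => by
    ext <;> simp

/-- Pairs of elements of weight `i` which agree up to weight `m + i`. Applying `mkdv_mem` to this
filtration of `R × R` bounds differences of values of `mkdv`. -/
def congruentPairs (Φ : ℕ → Submodule ℂ R) (m i : ℕ) : Submodule ℂ (R × R) :=
  (Φ i).comap (LinearMap.fst ℂ R R) ⊓ (Φ i).comap (LinearMap.snd ℂ R R) ⊓
    (Φ (m + i)).comap (LinearMap.fst ℂ R R - LinearMap.snd ℂ R R)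

variable {d} {Φ : ℕ → Submodule ℂ R}

theorem mem_congruentPairs {m i : ℕ} {a : R × R} :
    a ∈ congruentPairs Φ m i ↔ (a.1 ∈ Φ i ∧ a.2 ∈ Φ i) ∧ a.1 - a.2 ∈ Φ (m + i) :=
  Iff.rfl

variable [SetLike.GradedMonoid Φ]

instance congruentPairs.gradedMonoid (m : ℕ) : SetLike.GradedMonoid (congruentPairs Φ m) where
  one_mem := mem_congruentPairs.2
    ⟨⟨SetLike.one_mem_graded Φ, SetLike.one_mem_graded Φ⟩, by simp⟩
  mul_mem i j a b ha hb := by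
    obtain ⟨⟨ha₁, ha₂⟩, ha⟩ := mem_congruentPairs.1 ha
    obtain ⟨⟨hb₁, hb₂⟩, hb⟩ := mem_congruentPairs.1 hb
    refine mem_congruentPairs.2
      ⟨⟨SetLike.mul_mem_graded ha₁ hb₁, SetLike.mul_mem_graded ha₂ hb₂⟩, ?_⟩
    have h₁ : a.1 * (b.1 - b.2) ∈ Φ (m + (i + j)) :=
      add_left_comm i m j ▸ SetLike.mul_mem_graded ha₁ hb
    have h₂ : (a.1 - a.2) * b.2 ∈ Φ (m + (i + j)) :=
      add_assoc m i j ▸ SetLike.mul_mem_graded ha hb₂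
    convert add_mem h₁ h₂ using 1
    simp only [Prod.fst_mul, Prod.snd_mul]
    ring

theorem mkdv_sub_mem (hd : ∀ ⦃i a⦄, a ∈ Φ i → d a ∈ Φ (i + 1)) {v w : R} (hv : v ∈ Φ 1)
    (hw : w ∈ Φ 1) {m : ℕ} (h : v - w ∈ Φ (m + 1)) (N : ℕ) :
    mkdv d N v - mkdv d N w ∈ Φ (m + (2 * N + 1)) := by
  have hd' : ∀ ⦃i a⦄, a ∈ congruentPairs Φ m i → prodDeriv d a ∈ congruentPairs Φ m (i + 1) := by
    intro i a ha
    obtain ⟨⟨ha₁, ha₂⟩, ha⟩ := mem_congruentPairs.1 ha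
    exact mem_congruentPairs.2 ⟨⟨hd ha₁, hd ha₂⟩, map_sub d a.1 a.2 ▸ hd ha⟩
  have hmem := mkdv_mem hd' (mem_congruentPairs.2 ⟨⟨hv, hw⟩, h⟩ : (v, w) ∈ _) N
  have hfst := map_mkdv (d := prodDeriv d) (d' := d) (f := AlgHom.fst ℂ R R) (fun _ => rfl) N (v, w)
  have hsnd := map_mkdv (d := prodDeriv d) (d' := d) (f := AlgHom.snd ℂ R R) (fun _ => rfl) N (v, w)
  have hsub := (mem_congruentPairs.1 hmem).2
  exact congrArg₂ (· - ·) hfst hsnd ▸ hsub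

end Difference

section Darboux

variable (t : R)

/-- The first integral `A² - t(2AA'' - A'² + 4uA²)` of the equation
`A' = t(A''' + 4uA' + 2u'A)` satisfied by the generating series `A = ∑ L_k[u] t^k`. -/
def lenardIntegral (u A : R) : R :=
  A ^ 2 - t * (2 * A * d (d A) - d A ^ 2 + 4 * u * A ^ 2)

/-- The Darboux transformation `A ↦ A - 2t(A' + 2wA)'`, which takes the generating series of
`L_k[w' - w²]` to that of `L_k[-w' - w²]`. -/
def darboux (w A : R) : R := A - 2 * t * d (d A + 2 * w * A)

theorem deriv_two : d 2 = 0 := by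
  exact_mod_cast d.map_natCast 2

variable {t w A : R}

theorem deriv_darboux (ht : d t = 0) (hA : d A = t * (d (d (d A)) + 4 * (d w - w ^ 2) * d A
    + 2 * d (d w - w ^ 2) * A)) :
    d (darboux d t w A) - 2 * w * darboux d t w A = -(d A + 2 * w * A) := by
  simp only [darboux, map_add, map_sub, deriv_two, map_zero,
    Derivation.leibniz, sq w, ht, smul_eq_mul] at hA ⊢
  linear_combination (2 : R) * hA

theorem lenardIntegral_darboux (ht : d t = 0) (hA : d A = t * (d (d (d A))
    + 4 * (d w - w ^ 2) * d A + 2 * d (d w - w ^ 2) * A)) :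
    lenardIntegral d t (-d w - w ^ 2) (darboux d t w A) = lenardIntegral d t (d w - w ^ 2) A := by
  have hB : d (darboux d t w A) = 2 * w * darboux d t w A - (d A + 2 * w * A) := by
    linear_combination deriv_darboux d ht hA
  rw [lenardIntegral, hB]
  simp only [map_add, map_sub, deriv_two, Derivation.leibniz, hB, smul_eq_mul]
  simp only [lenardIntegral, darboux, map_add, deriv_two, Derivation.leibniz,
    smul_eq_mul]
  ring

end Darboux

section GeneratingSeries

/-- The coefficientwise derivation of `R⟦λ⟧`, where `λ` is a constant. -/
noncomputable def seriesDeriv : Derivation ℂ (PowerSeries R) (PowerSeries R) :=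
  Derivation.mk'
    { toFun := fun f => PowerSeries.mk fun n => d (PowerSeries.coeff n f)
      map_add' := fun f g => by ext; simp
      map_smul' := fun c f => by ext; simp }
    fun f g => by
      ext n
      simp only [LinearMap.coe_mk, AddHom.coe_mk, PowerSeries.coeff_mk, PowerSeries.coeff_mul,
        map_sum, Derivation.leibniz, smul_eq_mul, map_add, Finset.sum_add_distrib]
      congr 1
      exact Finset.Nat.sum_antidiagonal_swap
        (f := fun p => PowerSeries.coeff p.1 g * d (PowerSeries.coeff p.2 f))

theorem coeff_seriesDeriv (n : ℕ) (f : PowerSeries R) :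
    PowerSeries.coeff n (seriesDeriv d f) = d (PowerSeries.coeff n f) :=
  PowerSeries.coeff_mk n fun n => d (PowerSeries.coeff n f)

theorem seriesDeriv_C (a : R) : seriesDeriv d (PowerSeries.C a) = PowerSeries.C (d a) := by
  ext n
  rw [coeff_seriesDeriv, PowerSeries.coeff_C, PowerSeries.coeff_C]
  split <;> simp

theorem seriesDeriv_X : seriesDeriv d PowerSeries.X = 0 := by
  ext n
  rw [coeff_seriesDeriv, PowerSeries.coeff_X]
  split <;> simp

/-- The generating series `∑ L_k[u] λ^k` of the Lenard differential polynomials. -/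
noncomputable def lenardSeries (u : R) : PowerSeries R := PowerSeries.mk (lenard d u)

theorem constantCoeff_lenardSeries (u : R) :
    PowerSeries.constantCoeff (lenardSeries d u) = algebraMap ℂ R (1 / 2) := by
  rw [← PowerSeries.coeff_zero_eq_constantCoeff_apply, lenardSeries, PowerSeries.coeff_mk,
    lenard_zero]

theorem seriesDeriv_lenardSeries (u : R) :
    seriesDeriv d (lenardSeries d u) = PowerSeries.X *
      (seriesDeriv d (seriesDeriv d (seriesDeriv d (lenardSeries d u)))
        + 4 * PowerSeries.C u * seriesDeriv d (lenardSeries d u)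
        + 2 * PowerSeries.C (d u) * lenardSeries d u) := by
  ext n
  cases n with
  | zero =>
    rw [PowerSeries.coeff_zero_X_mul, coeff_seriesDeriv, lenardSeries, PowerSeries.coeff_mk,
      lenard_zero, Derivation.map_algebraMap]
  | succ n =>
    have h4 : (4 : PowerSeries R) = PowerSeries.C 4 := (map_ofNat PowerSeries.C 4).symm
    have h2 : (2 : PowerSeries R) = PowerSeries.C 2 := (map_ofNat PowerSeries.C 2).symm
    rw [PowerSeries.coeff_succ_X_mul, h4, h2, ← map_mul, ← map_mul]
    simp only [map_add, PowerSeries.coeff_C_mul, coeff_seriesDeriv, lenardSeries,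
      PowerSeries.coeff_mk, lenard_recursion]

theorem lenardIntegral_lenardSeries (u : R) :
    lenardIntegral (seriesDeriv d) PowerSeries.X (PowerSeries.C u) (lenardSeries d u) =
      algebraMap ℂ (PowerSeries R) (1 / 4) := by
  set A := lenardSeries d u
  have hcoeff (n : ℕ) : PowerSeries.coeff n A = lenard d u n := PowerSeries.coeff_mk n _
  ext n
  rw [PowerSeries.algebraMap_apply]
  cases n with
  | zero =>
    rw [lenardIntegral, map_sub, PowerSeries.coeff_zero_X_mul, PowerSeries.coeff_zero_C, sub_zero,
      PowerSeries.coeff_zero_eq_constantCoeff_apply, map_pow, constantCoeff_lenardSeries, ← map_pow]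
    norm_num
  | succ n =>
    have h4 : (4 : PowerSeries R) = PowerSeries.C 4 := (map_ofNat PowerSeries.C 4).symm
    have h2 : (2 : PowerSeries R) = PowerSeries.C 2 := (map_ofNat PowerSeries.C 2).symm
    rw [lenardIntegral, map_sub, PowerSeries.coeff_succ_X_mul, PowerSeries.coeff_C,
      if_neg n.succ_ne_zero, sub_eq_zero, h4, h2, ← map_mul, sq A, mul_assoc,
      sq (seriesDeriv d A), map_add, map_sub, PowerSeries.coeff_C_mul, PowerSeries.coeff_C_mul]
    simp only [PowerSeries.coeff_mul, coeff_seriesDeriv, hcoeff]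
    rw [lenard_quadratic, Finset.sum_add_distrib, Finset.sum_sub_distrib]
    simp only [Finset.mul_sum, mul_assoc]

theorem eq_of_lenardIntegral_eq {u : R} {A B : PowerSeries R}
    (hA : PowerSeries.constantCoeff A = algebraMap ℂ R (1 / 2))
    (hB : PowerSeries.constantCoeff B = algebraMap ℂ R (1 / 2))
    (h : lenardIntegral (seriesDeriv d) PowerSeries.X (PowerSeries.C u) A =
      lenardIntegral (seriesDeriv d) PowerSeries.X (PowerSeries.C u) B) : A = B := by
  have hunit : IsUnit (A + B) := by
    rw [PowerSeries.isUnit_iff_constantCoeff, map_add, hA, hB, ← map_add]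
    norm_num
  have hdvd {n : ℕ} {f : PowerSeries R} (hf : PowerSeries.X ^ n ∣ f) :
      PowerSeries.X ^ n ∣ seriesDeriv d f := by
    rw [PowerSeries.X_pow_dvd_iff] at hf ⊢
    intro m hm
    rw [coeff_seriesDeriv, hf m hm, map_zero]
  have key : ∀ n, PowerSeries.X ^ n ∣ A - B := by
    intro n
    induction n with
    | zero => exact one_dvd _
    | succ n ih =>
      rw [← hunit.dvd_mul_left]
      have expand : (A + B) * (A - B) = (2 * seriesDeriv d (seriesDeriv d A) * (A - B)
          + 2 * B * seriesDeriv d (seriesDeriv d (A - B))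
          - (seriesDeriv d A + seriesDeriv d B) * seriesDeriv d (A - B)
          + 4 * PowerSeries.C u * (A + B) * (A - B)) * PowerSeries.X := by
        simp only [lenardIntegral] at h
        simp only [map_sub]
        linear_combination h
      rw [expand, pow_succ]
      refine mul_dvd_mul_right (dvd_add (dvd_sub (dvd_add ?_ ?_) ?_) ?_) _
      · exact ih.mul_left _
      · exact (hdvd (hdvd ih)).mul_left _
      · exact (hdvd ih).mul_left _
      · exact ih.mul_left _
  refine sub_eq_zero.1 (PowerSeries.ext fun n => ?_)
  exact PowerSeries.X_pow_dvd_iff.1 (key (n + 1)) n n.lt_succ_self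

theorem seriesDeriv_lenardSeries_miura (w : R) :
    seriesDeriv d (lenardSeries d (d w - w ^ 2)) = PowerSeries.X *
      (seriesDeriv d (seriesDeriv d (seriesDeriv d (lenardSeries d (d w - w ^ 2))))
        + 4 * (seriesDeriv d (PowerSeries.C w) - PowerSeries.C w ^ 2)
          * seriesDeriv d (lenardSeries d (d w - w ^ 2))
        + 2 * seriesDeriv d (seriesDeriv d (PowerSeries.C w) - PowerSeries.C w ^ 2)
          * lenardSeries d (d w - w ^ 2)) := by
  rw [seriesDeriv_C, ← map_pow, ← map_sub, seriesDeriv_C]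
  exact seriesDeriv_lenardSeries d _

theorem lenardSeries_neg_sub_sq (w : R) :
    lenardSeries d (-d w - w ^ 2) = darboux (seriesDeriv d) PowerSeries.X (PowerSeries.C w)
      (lenardSeries d (d w - w ^ 2)) := by
  refine eq_of_lenardIntegral_eq d (u := -d w - w ^ 2) (constantCoeff_lenardSeries d _) ?_ ?_
  · simp only [darboux, map_sub, map_mul, PowerSeries.constantCoeff_X, mul_zero, zero_mul,
      sub_zero, constantCoeff_lenardSeries]
  · have h := lenardIntegral_darboux _ (seriesDeriv_X d) (seriesDeriv_lenardSeries_miura d w)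
    rw [seriesDeriv_C, ← map_pow, ← map_sub, ← map_neg, ← map_sub] at h
    rw [h, lenardIntegral_lenardSeries, lenardIntegral_lenardSeries]

theorem mkdv_neg (N : ℕ) (w : R) : mkdv d N (-w) = -mkdv d N w := by
  have h := congrArg (PowerSeries.coeff N) <|
    deriv_darboux _ (seriesDeriv_X d) (seriesDeriv_lenardSeries_miura d w)
  have h2 : (2 : PowerSeries R) = PowerSeries.C 2 := (map_ofNat PowerSeries.C 2).symm
  rw [← lenardSeries_neg_sub_sq, h2, ← map_mul] at h
  simp only [map_sub, map_neg, map_add, coeff_seriesDeriv, PowerSeries.coeff_C_mul, lenardSeries,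
    PowerSeries.coeff_mk] at h
  rw [mkdv, mkdv, map_neg, neg_sq]
  linear_combination h

end GeneratingSeries

end DifferentialAlgebra

section VanishAtInfty

open RatFunc (inftyValuation)
open WithZero

variable {F : Type*} [Field F] {k l : ℤ} {f g : RatFunc F}

open Classical in
/-- The subspace of rational functions which are `O(z⁻ᵏ)` at infinity. -/
noncomputable def vanishAtInfty (k : ℤ) : Submodule F (RatFunc F) where
  carrier := {f | inftyValuation F f ≤ exp (-k)}
  add_mem' hf hg := (inftyValuation F).map_add_le hf hg
  zero_mem' := by simp
  smul_mem' c f hf := by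
    rcases eq_or_ne c 0 with rfl | hc
    · simp
    · simpa [RatFunc.smul_eq_C_mul, RatFunc.inftyValuation.C F hc] using hf

open Classical in
theorem mem_vanishAtInfty : f ∈ vanishAtInfty k ↔ inftyValuation F f ≤ exp (-k) :=
  Iff.rfl

theorem vanishAtInfty_antitone : Antitone (vanishAtInfty (F := F)) := fun _ _ h _ hf =>
  (mem_vanishAtInfty.1 hf).trans (exp_le_exp.2 (neg_le_neg h))

theorem mul_mem_vanishAtInfty (hf : f ∈ vanishAtInfty k) (hg : g ∈ vanishAtInfty l) :
    f * g ∈ vanishAtInfty (k + l) := by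
  rw [mem_vanishAtInfty, map_mul, neg_add, exp_add]
  exact mul_le_mul' (mem_vanishAtInfty.1 hf) (mem_vanishAtInfty.1 hg)

theorem C_mem_vanishAtInfty (c : F) : RatFunc.C c ∈ vanishAtInfty 0 := by
  classical
  rcases eq_or_ne c 0 with rfl | hc
  · simp
  · simp [mem_vanishAtInfty, RatFunc.inftyValuation.C F hc]

theorem X_mem_vanishAtInfty : (RatFunc.X : RatFunc F) ∈ vanishAtInfty (-1) := by
  rw [mem_vanishAtInfty, RatFunc.inftyValuation.X, neg_neg]

theorem inv_X_mem_vanishAtInfty : (RatFunc.X : RatFunc F)⁻¹ ∈ vanishAtInfty 1 := by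
  rw [mem_vanishAtInfty, map_inv₀, RatFunc.inftyValuation.X, exp_neg]

theorem algebraMap_mem_vanishAtInfty {p : F[X]} (hp : p ≠ 0) :
    algebraMap F[X] (RatFunc F) p ∈ vanishAtInfty k ↔ (p.natDegree : ℤ) ≤ -k := by
  classical
  rw [mem_vanishAtInfty, RatFunc.inftyValuation_apply, RatFunc.inftyValuation.polynomial F hp,
    exp_le_exp]

theorem eq_zero_of_forall_mem_vanishAtInfty (h : ∀ k : ℕ, f ∈ vanishAtInfty (k : ℤ)) : f = 0 := by
  classical
  by_contra h0
  have := h ((-f.intDegree).toNat + 1)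
  rw [mem_vanishAtInfty, RatFunc.inftyValuation_apply, RatFunc.inftyValuation_of_nonzero F h0,
    exp_le_exp] at this
  lia

instance vanishAtInfty.gradedMonoid :
    SetLike.GradedMonoid fun k : ℕ => vanishAtInfty (F := F) k where
  one_mem := map_one (RatFunc.C (K := F)) ▸ C_mem_vanishAtInfty 1
  mul_mem i j _ _ hf hg := by
    simpa only [Nat.cast_add] using mul_mem_vanishAtInfty hf hg

end VanishAtInfty

section RatDeriv

open RatFunc (inftyValuation)
open WithZero

open Classical in
theorem inftyValuation_derivative_le (p : ℂ[X]) :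
    inftyValuation ℂ (algebraMap ℂ[X] (RatFunc ℂ) (derivative p)) ≤
      inftyValuation ℂ (algebraMap ℂ[X] (RatFunc ℂ) p) * exp (-1) := by
  rcases eq_or_ne (derivative p) 0 with h | h
  · simp [h]
  · have hp : p ≠ 0 := by rintro rfl; exact h derivative_zero
    have hlt := natDegree_derivative_lt fun h0 => h (derivative_of_natDegree_zero h0)
    rw [RatFunc.inftyValuation_apply, RatFunc.inftyValuation_apply,
      RatFunc.inftyValuation.polynomial ℂ h, RatFunc.inftyValuation.polynomial ℂ hp, ← exp_add,
      exp_le_exp]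
    lia

theorem ratDeriv_mul_denom (f : RatFunc ℂ) : ratDeriv f * algebraMap ℂ[X] (RatFunc ℂ) f.denom =
    algebraMap ℂ[X] (RatFunc ℂ) (derivative f.num)
      - f * algebraMap ℂ[X] (RatFunc ℂ) (derivative f.denom) := by
  have hq : algebraMap ℂ[X] (RatFunc ℂ) f.denom ≠ 0 :=
    RatFunc.algebraMap_ne_zero f.denom_ne_zero
  have h := congrArg ratDeriv ((div_eq_iff hq).1 f.num_div_denom)
  rw [Derivation.leibniz, ratDeriv_algebraMap, ratDeriv_algebraMap, smul_eq_mul, smul_eq_mul] at h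
  linear_combination -h

open Classical in
theorem inftyValuation_ratDeriv_le (f : RatFunc ℂ) :
    inftyValuation ℂ (ratDeriv f) ≤ inftyValuation ℂ f * exp (-1) := by
  have hq : algebraMap ℂ[X] (RatFunc ℂ) f.denom ≠ 0 :=
    RatFunc.algebraMap_ne_zero f.denom_ne_zero
  rw [← mul_le_mul_iff_left₀ (zero_lt_iff.2 ((inftyValuation ℂ).ne_zero_iff.2 hq)), ← map_mul,
    ratDeriv_mul_denom]
  refine (inftyValuation ℂ).map_sub_le ?_ ?_
  · refine (inftyValuation_derivative_le _).trans_eq ?_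
    rw [mul_right_comm, ← map_mul, ← (div_eq_iff hq).1 f.num_div_denom]
  · rw [map_mul, mul_assoc, mul_comm (exp _)]
    gcongr
    exact inftyValuation_derivative_le _

theorem ratDeriv_mem_vanishAtInfty {k : ℤ} {f : RatFunc ℂ} (hf : f ∈ vanishAtInfty k) :
    ratDeriv f ∈ vanishAtInfty (k + 1) := by
  rw [mem_vanishAtInfty, neg_add, exp_add]
  exact (inftyValuation_ratDeriv_le f).trans (mul_le_mul_left (mem_vanishAtInfty.1 hf) _)

theorem ratDeriv_div_self_mem (f : RatFunc ℂ) : ratDeriv f / f ∈ vanishAtInfty 1 := by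
  rw [mem_vanishAtInfty, map_div₀]
  exact div_le_of_le_mul₀ zero_le zero_le (mul_comm (exp (-1)) _ ▸ inftyValuation_ratDeriv_le f)

theorem eq_C_of_ratDeriv_eq_zero {f : RatFunc ℂ} (hf : ratDeriv f = 0) :
    ∃ c : ℂ, f = RatFunc.C c := by
  have hq := f.denom_ne_zero
  have hq' : algebraMap ℂ[X] (RatFunc ℂ) f.denom ≠ 0 := RatFunc.algebraMap_ne_zero hq
  have hcross : derivative f.num * f.denom = f.num * derivative f.denom := by
    apply RatFunc.algebraMap_injective ℂ
    have h := ratDeriv_mul_denom f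
    rw [hf, zero_mul, eq_comm, sub_eq_zero] at h
    rw [map_mul, map_mul, h, mul_right_comm, ← (div_eq_iff hq').1 f.num_div_denom]
  have hdvd : f.denom ∣ derivative f.denom :=
    f.isCoprime_num_denom.symm.dvd_of_dvd_mul_left (hcross ▸ dvd_mul_left _ _)
  have hdenom : derivative f.denom = 0 := dvd_derivative_iff.1 hdvd
  have hnum : derivative f.num = 0 := by
    rw [hdenom, mul_zero] at hcross
    exact (mul_eq_zero.1 hcross).resolve_right hq
  rw [derivative_eq_zero, natDegree_eq_zero] at hnum hdenom
  obtain ⟨a, ha⟩ := hnum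
  obtain ⟨b, hb⟩ := hdenom
  refine ⟨a / b, ?_⟩
  rw [← f.num_div_denom, ← ha, ← hb, RatFunc.algebraMap_C, RatFunc.algebraMap_C, map_div₀]

end RatDeriv

section Hirota

/-- The Hirota bilinear form `p'' q - 2 p' q' + p q''` of a differential algebra. Two consecutive
Yablonskii–Vorob'ev polynomials annihilate it. -/
def hirota {R A : Type*} [CommRing R] [CommRing A] [Algebra R A] (d : Derivation R A A)
    (p q : A) : A :=
  d (d p) * q - 2 * d p * d q + p * d (d q)

section Algebra

variable {R A : Type*} [CommRing R] [CommRing A] [Algebra R A] (d : Derivation R A A)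

theorem hirota_comm (p q : A) : hirota d p q = hirota d q p := by
  simp only [hirota]
  ring

theorem hirota_mul_self (f q : A) : hirota d (f * q) q = d (d f) * q ^ 2 + f * hirota d q q := by
  simp only [hirota, Derivation.leibniz, smul_eq_mul, map_add]
  ring

theorem hirota_mul_self_eq_zero [NoZeroDivisors A] {d : Derivation R A A} {f g q : A} (hf : f ≠ 0)
    (hfg : d (d g) * f = g * d (d f)) (h : hirota d (f * q) q = 0) : hirota d (g * q) q = 0 := by
  rw [hirota_mul_self] at h ⊢
  refine (mul_eq_zero.1 ?_).resolve_left hf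
  linear_combination q ^ 2 * hfg + g * h

theorem map_hirota {B : Type*} [CommRing B] [Algebra R B] {d : Derivation R A A}
    {d' : Derivation R B B} {f : A →ₐ[R] B} (hf : ∀ a, f (d a) = d' (f a)) (p q : A) :
    f (hirota d p q) = hirota d' (f p) (f q) := by
  simp only [hirota, map_add, map_sub, map_mul, map_ofNat, hf]

end Algebra

section RootMultiplicity

variable {R : Type*} [CommRing R]

theorem X_sub_C_mul_derivative_pow_mul (x : R) (a : ℕ) (p : R[X]) :
    (X - C x) * derivative ((X - C x) ^ a * p) =
      (X - C x) ^ a * ((a : R[X]) * p + (X - C x) * derivative p) := by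
  rw [derivative_mul, derivative_X_sub_C_pow, map_natCast]
  cases a with
  | zero => simp
  | succ a => rw [Nat.add_sub_cancel]; ring

theorem X_sub_C_sq_mul_derivative_derivative_pow_mul (x : R) (a : ℕ) (p : R[X]) :
    (X - C x) ^ 2 * derivative (derivative ((X - C x) ^ a * p)) =
      (X - C x) ^ a * (((a : R[X]) ^ 2 - (a : R[X])) * p + 2 * (a : R[X]) * (X - C x) * derivative p
        + (X - C x) ^ 2 * derivative (derivative p)) := by
  have h := congrArg derivative (X_sub_C_mul_derivative_pow_mul x a p)
  rw [derivative_mul, derivative_X_sub_C] at h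
  have h' := X_sub_C_mul_derivative_pow_mul x a ((a : R[X]) * p + (X - C x) * derivative p)
  have hq : derivative ((a : R[X]) * p + (X - C x) * derivative p) =
      (a : R[X]) * derivative p + (derivative p + (X - C x) * derivative (derivative p)) := by
    simp
  rw [hq] at h'
  linear_combination (X - C x) * h + h' - X_sub_C_mul_derivative_pow_mul x a p

theorem X_sub_C_sq_mul_hirota (x : R) (a b : ℕ) (p q : R[X]) :
    (X - C x) ^ 2 * hirota derivative' ((X - C x) ^ a * p) ((X - C x) ^ b * q) =
      (X - C x) ^ (a + b) * ((((a : R[X]) - (b : R[X])) ^ 2 - ((a : R[X]) + (b : R[X]))) * (p * q)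
        + (X - C x) * (2 * ((a : R[X]) - (b : R[X])) * (derivative p * q - p * derivative q))
        + (X - C x) ^ 2 * hirota derivative' p q) := by
  simp only [hirota, derivative'_apply]
  linear_combination
    ((X - C x) ^ b * q) * X_sub_C_sq_mul_derivative_derivative_pow_mul x a p
    + ((X - C x) ^ a * p) * X_sub_C_sq_mul_derivative_derivative_pow_mul x b q
    - 2 * ((X - C x) * derivative ((X - C x) ^ b * q)) * X_sub_C_mul_derivative_pow_mul x a p
    - 2 * ((X - C x) ^ a * ((a : R[X]) * p + (X - C x) * derivative p)) *
      X_sub_C_mul_derivative_pow_mul x b q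

variable {F : Type*} [Field F]

theorem exists_eq_pow_rootMultiplicity_mul_eval_ne_zero {p : F[X]} (hp : p ≠ 0) (x : F) :
    ∃ q, p = (X - C x) ^ p.rootMultiplicity x * q ∧ q.eval x ≠ 0 := by
  obtain ⟨q, hq, hx⟩ := exists_eq_pow_rootMultiplicity_mul_and_not_dvd p hp x
  exact ⟨q, hq, fun h => hx (dvd_iff_isRoot.2 h)⟩

theorem rootMultiplicity_X_sub_C_pow_mul {p : F[X]} {x : F} (hp : p.eval x ≠ 0) (m : ℕ) :
    ((X - C x) ^ m * p).rootMultiplicity x = m := by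
  have h0 : p ≠ 0 := by rintro rfl; exact hp eval_zero
  rw [mul_comm, rootMultiplicity_mul_X_sub_C_pow h0, rootMultiplicity_eq_zero hp, zero_add]

variable [CharZero F] {A B P Q D : F[X]} {x : F}

theorem rootMultiplicity_sub_sq_of_hirota_eq_zero (hP : P ≠ 0) (hQ : Q ≠ 0)
    (h : hirota derivative' P Q = 0) (x : F) :
    ((P.rootMultiplicity x : ℤ) - Q.rootMultiplicity x) ^ 2 =
      P.rootMultiplicity x + Q.rootMultiplicity x := by
  obtain ⟨p, hp, hpx⟩ := exists_eq_pow_rootMultiplicity_mul_eval_ne_zero hP x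
  obtain ⟨q, hq, hqx⟩ := exists_eq_pow_rootMultiplicity_mul_eval_ne_zero hQ x
  generalize P.rootMultiplicity x = a at hp ⊢
  generalize Q.rootMultiplicity x = b at hq ⊢
  have h' := X_sub_C_sq_mul_hirota x a b p q
  rw [← hp, ← hq, h, mul_zero, eq_comm, mul_eq_zero,
    or_iff_right (pow_ne_zero _ (X_sub_C_ne_zero x))] at h'
  have hx : ((a - b) ^ 2 - (a + b) : F) = 0 := by simpa [hpx, hqx] using congrArg (eval x) h'
  exact_mod_cast sub_eq_zero.1 hx

theorem rootMultiplicity_le_of_hirota_eq_zero (hP : P ≠ 0) (hQ : Q ≠ 0)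
    (h : hirota derivative' P Q = 0) (x : F) :
    P.rootMultiplicity x ≤ 2 * Q.rootMultiplicity x + 1 := by
  have := rootMultiplicity_sub_sq_of_hirota_eq_zero hP hQ h x
  by_contra! hlt
  zify at hlt
  nlinarith

theorem rootMultiplicity_wronskian_add_one (hA : A.eval x ≠ 0) (hB0 : B ≠ 0) (hB : B.eval x = 0) :
    (wronskian A B).rootMultiplicity x + 1 = B.rootMultiplicity x := by
  have hm : B.rootMultiplicity x ≠ 0 := ((rootMultiplicity_pos hB0).2 hB).ne'
  obtain ⟨b, hb, hbx⟩ := exists_eq_pow_rootMultiplicity_mul_eval_ne_zero hB0 x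
  generalize B.rootMultiplicity x = m at hb hm ⊢
  have hW : (X - C x) * wronskian A B = (X - C x) ^ m *
      (A * ((m : F[X]) * b + (X - C x) * derivative b) - (X - C x) * derivative A * b) := by
    rw [hb, wronskian]
    linear_combination A * X_sub_C_mul_derivative_pow_mul x m b
  have hx : (A * ((m : F[X]) * b + (X - C x) * derivative b)
      - (X - C x) * derivative A * b).eval x ≠ 0 := by
    simp [hA, hbx, hm]
  have hmult := rootMultiplicity_X_sub_C_pow_mul hx m
  rw [← hW] at hmult
  have hW0 : (X - C x) * wronskian A B ≠ 0 := by
    intro h0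
    rw [h0, rootMultiplicity_zero] at hmult
    exact hm hmult.symm
  rw [rootMultiplicity_mul hW0, rootMultiplicity_X_sub_C_self] at hmult
  lia

theorem isUnit_of_wronskian_eq [IsAlgClosed F] (hP : P ≠ 0) (hQ : Q ≠ 0)
    (h : hirota derivative' P Q = 0) (hD : D ≠ 0) (hAD : IsCoprime A D) {c : F} (hc : c ≠ 0)
    (hW : wronskian A (D * P) * P ^ 2 = C c * Q ^ 2 * (D * P) ^ 2) : IsUnit D := by
  by_contra hu
  obtain ⟨x, hx⟩ := IsAlgClosed.exists_root D (degree_pos_of_ne_zero_of_nonunit hD hu).ne'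
  have hA : A.eval x ≠ 0 := fun hA => by
    simpa [hA, hx.eq_zero] using congrArg (eval x) hAD.choose_spec.choose_spec
  have hDx := (rootMultiplicity_pos hD).2 hx
  have hDP := mul_ne_zero hD hP
  have hPQ := rootMultiplicity_le_of_hirota_eq_zero hP hQ h x
  have hmult := rootMultiplicity_wronskian_add_one hA hDP (by simp [hx.eq_zero])
  have hrhs : C c * Q ^ 2 * (D * P) ^ 2 ≠ 0 :=
    mul_ne_zero (mul_ne_zero (C_ne_zero.2 hc) (pow_ne_zero 2 hQ)) (pow_ne_zero 2 hDP)
  have hcount := congrArg (rootMultiplicity x) hW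
  rw [rootMultiplicity_mul (hW ▸ hrhs), rootMultiplicity_mul hrhs,
    rootMultiplicity_mul (left_ne_zero_of_mul hrhs), rootMultiplicity_C] at hcount
  simp only [sq, rootMultiplicity_mul, mul_ne_zero hP hP, mul_ne_zero hQ hQ, ne_eq,
    mul_ne_zero hDP hDP, hDP, not_false_eq_true] at hcount hmult
  lia

end RootMultiplicity

theorem hirota_algebraMap (P Q : ℂ[X]) :
    hirota ratDeriv (algebraMap ℂ[X] (RatFunc ℂ) P) (algebraMap ℂ[X] (RatFunc ℂ) Q) =
      algebraMap ℂ[X] (RatFunc ℂ) (hirota derivative' P Q) :=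
  (map_hirota (d := derivative') (f := IsScalarTower.toAlgHom ℂ ℂ[X] (RatFunc ℂ))
    (fun p => (ratDeriv_algebraMap p).symm) P Q).symm

theorem exists_polynomial_of_ratDeriv_div_eq {P Q : ℂ[X]} (hP : P ≠ 0) (hQ : Q ≠ 0)
    (h : hirota derivative' P Q = 0) {c : ℂ} (hc : c ≠ 0) {f : RatFunc ℂ}
    (hf : ratDeriv (f / algebraMap ℂ[X] (RatFunc ℂ) P) =
      RatFunc.C c * algebraMap ℂ[X] (RatFunc ℂ) Q ^ 2 / algebraMap ℂ[X] (RatFunc ℂ) P ^ 2) :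
    ∃ R : ℂ[X], algebraMap ℂ[X] (RatFunc ℂ) R = f := by
  have hD := f.denom_ne_zero
  have hP' := RatFunc.algebraMap_ne_zero hP
  have hDP := RatFunc.algebraMap_ne_zero (mul_ne_zero hD hP)
  have hfP : f / algebraMap ℂ[X] (RatFunc ℂ) P =
      algebraMap ℂ[X] (RatFunc ℂ) f.num / algebraMap ℂ[X] (RatFunc ℂ) (f.denom * P) := by
    rw [map_mul, ← div_div, f.num_div_denom]
  have hW : wronskian f.num (f.denom * P) * P ^ 2 = C (-c) * Q ^ 2 * (f.denom * P) ^ 2 := by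
    apply RatFunc.algebraMap_injective ℂ
    rw [hfP, Derivation.leibniz_div, ratDeriv_algebraMap, ratDeriv_algebraMap] at hf
    simp only [smul_eq_mul] at hf
    field_simp at hf
    simp only [wronskian, map_sub, map_mul, map_pow, map_neg, RatFunc.algebraMap_C] at hf ⊢
    linear_combination -hf
  have hu := isUnit_of_wronskian_eq hP hQ h hD f.isCoprime_num_denom (neg_ne_zero.2 hc) hW
  exact ⟨f.num, by
    rw [← div_one (algebraMap _ _ f.num), ← map_one (algebraMap ℂ[X] (RatFunc ℂ)),
      ← f.monic_denom.eq_one_of_isUnit hu, f.num_div_denom]⟩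

theorem exists_polynomial_div_eq_of_wronskian_eq {P Q : ℂ[X]} (hP : P ≠ 0) (hQ : Q ≠ 0)
    (h : hirota derivative' P Q = 0) {c : ℂ} (hc : c ≠ 0) {ψ φ : RatFunc ℂ}
    (hψ : algebraMap ℂ[X] (RatFunc ℂ) P / algebraMap ℂ[X] (RatFunc ℂ) Q = ψ)
    (hW : ratDeriv φ * ψ - φ * ratDeriv ψ = RatFunc.C c) :
    ∃ R : ℂ[X], algebraMap ℂ[X] (RatFunc ℂ) R / algebraMap ℂ[X] (RatFunc ℂ) Q = φ := by
  have hP' := RatFunc.algebraMap_ne_zero hP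
  have hQ' := RatFunc.algebraMap_ne_zero hQ
  have hquot : φ * algebraMap ℂ[X] (RatFunc ℂ) Q / algebraMap ℂ[X] (RatFunc ℂ) P = φ / ψ := by
    rw [← hψ]
    field_simp
  have hderiv : ratDeriv (φ / ψ) = RatFunc.C c * algebraMap ℂ[X] (RatFunc ℂ) Q ^ 2 /
      algebraMap ℂ[X] (RatFunc ℂ) P ^ 2 := by
    rw [Derivation.leibniz_div, smul_eq_mul, smul_eq_mul, smul_eq_mul, mul_comm ψ, hW, ← hψ]
    field_simp
  obtain ⟨R, hR⟩ := exists_polynomial_of_ratDeriv_div_eq hP hQ h hc (hquot ▸ hderiv)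
  exact ⟨R, by rw [hR, mul_div_cancel_right₀ _ hQ']⟩

end Hirota

section Backlund

variable {K : Type*} [Field K] [Algebra ℂ K] {d : Derivation ℂ K K} {N : ℕ} {x ψ φ : K} {α : ℂ}

theorem deriv_neg_logDeriv_sub_sq (d : Derivation ℂ K K) (hψ : ψ ≠ 0) :
    d (-(d ψ / ψ)) - (-(d ψ / ψ)) ^ 2 = -(d (d ψ) / ψ) := by
  rw [map_neg, Derivation.leibniz_div]
  simp only [smul_eq_mul]
  field_simp
  ring

theorem mkdv_neg_logDeriv (d : Derivation ℂ K K) (N : ℕ) (hψ : ψ ≠ 0) :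
    mkdv d N (-(d ψ / ψ)) =
      d (lenard d (-(d (d ψ) / ψ)) N) - 2 * (d ψ / ψ) * lenard d (-(d (d ψ) / ψ)) N := by
  rw [mkdv, deriv_neg_logDeriv_sub_sq d hψ]
  ring

theorem wronskian_eq_of_mkdv_eq (hx : d x = 1) (hψ : ψ ≠ 0)
    (h : mkdv d N (d ψ / ψ) = x * (d ψ / ψ) + algebraMap ℂ K α)
    (hφ : φ * ψ = x - 2 * lenard d (-(d (d ψ) / ψ)) N) :
    d φ * ψ - φ * d ψ = 2 * algebraMap ℂ K α + 1 := by
  have hodd := mkdv_neg d N (d ψ / ψ)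
  rw [h, mkdv_neg_logDeriv d N hψ] at hodd
  have hdφ := congrArg d hφ
  simp only [Derivation.leibniz, map_sub, smul_eq_mul, hx, deriv_two, mul_zero, add_zero] at hdφ
  have hcancel : φ * d ψ = d ψ / ψ * (φ * ψ) := by field_simp
  rw [hφ] at hcancel
  linear_combination hdφ - 2 * hodd - 2 * hcancel

theorem deriv_deriv_mul_eq_of_wronskian_eq (h : d φ * ψ - φ * d ψ = 2 * algebraMap ℂ K α + 1) :
    d (d φ) * ψ = φ * d (d ψ) := by
  have hd := congrArg d h
  simp only [Derivation.leibniz, map_sub, map_add, smul_eq_mul, deriv_two,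
    Derivation.map_algebraMap, Derivation.map_one_eq_zero] at hd
  linear_combination hd

theorem mkdv_neg_logDeriv_eq_of_wronskian_eq (hx : d x = 1) (hψ : ψ ≠ 0) (hφ0 : φ ≠ 0)
    (hW : d φ * ψ - φ * d ψ = 2 * algebraMap ℂ K α + 1)
    (hφ : φ * ψ = x - 2 * lenard d (-(d (d ψ) / ψ)) N) :
    mkdv d N (-(d φ / φ)) = x * -(d φ / φ) + algebraMap ℂ K (α + 1) := by
  have : CharZero K := charZero_of_injective_algebraMap (algebraMap ℂ K).injective
  have hpot : d (d φ) / φ = d (d ψ) / ψ := by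
    rw [div_eq_div_iff hφ0 hψ, deriv_deriv_mul_eq_of_wronskian_eq hW, mul_comm]
  have hdφ := congrArg d hφ
  simp only [Derivation.leibniz, map_sub, smul_eq_mul, hx, deriv_two, mul_zero, add_zero] at hdφ
  have hcancel : ψ * d φ = d φ / φ * (φ * ψ) := by field_simp
  rw [hφ] at hcancel
  rw [mkdv_neg_logDeriv d N hφ0, hpot, map_add, map_one]
  refine mul_left_cancel₀ (two_ne_zero (α := K)) ?_
  linear_combination hdφ + hW - 2 * hcancel

end Backlund

section Existence

variable {N n : ℕ} {P Q R : ℂ[X]} {α : ℂ}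

theorem painleveII_eq_zero_iff {w : RatFunc ℂ} :
    painleveII N w α = 0 ↔ mkdv ratDeriv N w = RatFunc.X * w + RatFunc.C α := by
  rw [painleveII, sub_sub, sub_eq_zero, mkdv]

theorem ratDeriv_X : ratDeriv (RatFunc.X : RatFunc ℂ) = 1 := by
  rw [← RatFunc.algebraMap_X, ratDeriv_algebraMap, derivative_X, map_one]

theorem logDerivQuot_mem (P Q : ℂ[X]) : logDerivQuot P Q ∈ vanishAtInfty 1 :=
  ratDeriv_div_self_mem _

theorem logDerivQuot_eq (hP : P ≠ 0) (hQ : Q ≠ 0) : logDerivQuot P Q =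
    algebraMap ℂ[X] (RatFunc ℂ) (derivative P) / algebraMap ℂ[X] (RatFunc ℂ) P
      - algebraMap ℂ[X] (RatFunc ℂ) (derivative Q) / algebraMap ℂ[X] (RatFunc ℂ) Q := by
  have hP' := RatFunc.algebraMap_ne_zero hP
  have hQ' := RatFunc.algebraMap_ne_zero hQ
  rw [logDerivQuot, Derivation.leibniz_div, ratDeriv_algebraMap, ratDeriv_algebraMap]
  simp only [smul_eq_mul]
  field_simp

theorem logDerivQuot_comm (hP : P ≠ 0) (hQ : Q ≠ 0) : logDerivQuot Q P = -logDerivQuot P Q := by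
  rw [logDerivQuot_eq hP hQ, logDerivQuot_eq hQ hP, neg_sub]

theorem monic_of_sub_mem_vanishAtInfty (hQ : Q.Monic)
    (h : algebraMap ℂ[X] (RatFunc ℂ) (P - Q) ∈ vanishAtInfty (1 - Q.natDegree)) : P.Monic := by
  rw [← add_sub_cancel Q P]
  rcases eq_or_ne (P - Q) 0 with h0 | h0
  · rwa [h0, add_zero]
  · rw [algebraMap_mem_vanishAtInfty h0] at h
    exact hQ.add_of_left (degree_lt_degree (by lia))

theorem ratDeriv_mem_vanishAtInfty_natCast ⦃i : ℕ⦄ ⦃f : RatFunc ℂ⦄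
    (hf : f ∈ vanishAtInfty (i : ℤ)) : ratDeriv f ∈ vanishAtInfty ((i + 1 : ℕ) : ℤ) :=
  Nat.cast_succ (R := ℤ) i ▸ ratDeriv_mem_vanishAtInfty hf

theorem lenard_neg_ratDeriv_div_mem {ψ : RatFunc ℂ} (hψ : ψ ≠ 0) (N : ℕ) :
    lenard ratDeriv (-(ratDeriv (ratDeriv ψ) / ψ)) N ∈ vanishAtInfty 0 := by
  have hw := neg_mem (ratDeriv_div_self_mem ψ)
  have hu := sub_mem (ratDeriv_mem_vanishAtInfty hw) (sq (_ : RatFunc ℂ) ▸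
    mul_mem_vanishAtInfty hw hw)
  rw [deriv_neg_logDeriv_sub_sq ratDeriv hψ] at hu
  exact vanishAtInfty_antitone (by positivity) <|
    lenard_mem (Φ := fun k : ℕ => vanishAtInfty k) ratDeriv_mem_vanishAtInfty_natCast hu N

theorem monic_of_div_mul_div_eq (hP : P.Monic) (hQ : Q.Monic) {L : RatFunc ℂ}
    (hL : L ∈ vanishAtInfty 0)
    (h : algebraMap ℂ[X] (RatFunc ℂ) R / algebraMap ℂ[X] (RatFunc ℂ) Q *
      (algebraMap ℂ[X] (RatFunc ℂ) P / algebraMap ℂ[X] (RatFunc ℂ) Q) = RatFunc.X - 2 * L) :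
    R.Monic := by
  have hQ' := RatFunc.algebraMap_ne_zero hQ.ne_zero
  refine hP.of_mul_monic_right (monic_of_sub_mem_vanishAtInfty (monic_X.mul (hQ.pow 2)) ?_)
  have hsub : algebraMap ℂ[X] (RatFunc ℂ) (R * P - X * Q ^ 2) =
      -(L + L) * algebraMap ℂ[X] (RatFunc ℂ) (Q ^ 2) := by
    rw [div_mul_div_comm, div_eq_iff (mul_ne_zero hQ' hQ')] at h
    simp only [map_sub, map_mul, map_pow, RatFunc.algebraMap_X]
    linear_combination h
  have hQ2 := (algebraMap_mem_vanishAtInfty (k := -(Q ^ 2).natDegree) (hQ.pow 2).ne_zero).2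
    (neg_neg _).ge
  rw [hsub, natDegree_X_mul (hQ.pow 2).ne_zero]
  exact vanishAtInfty_antitone (by lia) (mul_mem_vanishAtInfty (neg_mem (add_mem hL hL)) hQ2)

/-- The data preserved by the Bäcklund transformation: `P` and `Q` are candidates for the
Yablonskii–Vorob'ev polynomials number `n - 1` and `n`. -/
structure IsBacklundPair (N n : ℕ) (P Q : ℂ[X]) : Prop where
  monic_left : P.Monic
  monic_right : Q.Monic
  hirota_eq_zero : hirota derivative' P Q = 0
  painleveII_eq_zero : painleveII N (logDerivQuot P Q) n = 0

theorem isBacklundPair_one_X (hN : 1 ≤ N) : IsBacklundPair N 1 1 X where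
  monic_left := monic_one
  monic_right := monic_X
  hirota_eq_zero := by simp [hirota]
  painleveII_eq_zero := by
    have hX : (RatFunc.X : RatFunc ℂ) ≠ 0 := RatFunc.X_ne_zero
    have hw : logDerivQuot 1 X = -RatFunc.X⁻¹ := by
      simp [logDerivQuot_eq one_ne_zero X_ne_zero]
    have hu : ratDeriv (-RatFunc.X⁻¹) - (-RatFunc.X⁻¹) ^ 2 = 0 := by
      rw [map_neg, Derivation.leibniz_inv, ratDeriv_X, smul_eq_mul]
      ring
    obtain ⟨k, rfl⟩ := Nat.exists_eq_add_of_le' hN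
    rw [painleveII_eq_zero_iff, hw, mkdv, hu, lenard_succ_zero]
    simp [hX]

theorem IsBacklundPair.exists_next (h : IsBacklundPair N n P Q) :
    ∃ R, IsBacklundPair N (n + 1) Q R := by
  have hP := h.monic_left.ne_zero
  have hQ := h.monic_right.ne_zero
  have hQ' := RatFunc.algebraMap_ne_zero hQ
  have hsol := painleveII_eq_zero_iff.1 h.painleveII_eq_zero
  have hhir := hirota_algebraMap P Q
  obtain ⟨ψ, hψ⟩ : ∃ ψ, algebraMap ℂ[X] (RatFunc ℂ) P / algebraMap ℂ[X] (RatFunc ℂ) Q = ψ :=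
    ⟨_, rfl⟩
  have hψ0 : ψ ≠ 0 := hψ ▸ div_ne_zero (RatFunc.algebraMap_ne_zero hP) hQ'
  rw [logDerivQuot, hψ] at hsol
  rw [(div_eq_iff hQ').1 hψ, h.hirota_eq_zero, map_zero] at hhir
  obtain ⟨φ, hφ⟩ : ∃ φ, φ * ψ = RatFunc.X -
      2 * lenard ratDeriv (-(ratDeriv (ratDeriv ψ) / ψ)) N := ⟨_, div_mul_cancel₀ _ hψ0⟩
  have hW := wronskian_eq_of_mkdv_eq ratDeriv_X hψ0 hsol hφ
  obtain ⟨R, hR⟩ := exists_polynomial_div_eq_of_wronskian_eq hP hQ h.hirota_eq_zero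
    (c := 2 * n + 1) (by exact_mod_cast Nat.succ_ne_zero (2 * n)) hψ
    (by rw [hW, RatFunc.algebraMap_eq_C, map_add, map_mul, map_ofNat, map_one])
  have hRmonic : R.Monic := by
    refine monic_of_div_mul_div_eq h.monic_left h.monic_right
      (lenard_neg_ratDeriv_div_mem hψ0 N) ?_
    rw [hR, hψ, hφ]
  have hφ0 : φ ≠ 0 := hR ▸ div_ne_zero (RatFunc.algebraMap_ne_zero hRmonic.ne_zero) hQ'
  have hQR : logDerivQuot Q R = -(ratDeriv φ / φ) := by
    rw [logDerivQuot_comm hRmonic.ne_zero hQ, logDerivQuot, hR]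
  refine ⟨R, h.monic_right, hRmonic, ?_, ?_⟩
  · apply RatFunc.algebraMap_injective ℂ
    rw [hirota_comm, ← hirota_algebraMap, map_zero, (div_eq_iff hQ').1 hR]
    exact hirota_mul_self_eq_zero hψ0 (deriv_deriv_mul_eq_of_wronskian_eq hW) hhir
  · rw [painleveII_eq_zero_iff, hQR, Nat.cast_succ]
    exact mkdv_neg_logDeriv_eq_of_wronskian_eq ratDeriv_X hψ0 hφ0 hW hφ

theorem exists_isYablonskiiVorobev (hN : 1 ≤ N) : ∃ Q, IsYablonskiiVorobev N Q := by
  choose! next hnext using fun n P Q (h : IsBacklundPair N n P Q) => h.exists_next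
  let pair (n : ℕ) : ℂ[X] × ℂ[X] := n.rec (1, X) fun n PQ => (PQ.2, next (n + 1) PQ.1 PQ.2)
  have hpair (n : ℕ) : IsBacklundPair N (n + 1) (pair n).1 (pair n).2 := by
    induction n with
    | zero => exact isBacklundPair_one_X hN
    | succ n ih => exact hnext _ _ _ ih
  refine ⟨fun n => (pair n).1, fun n => (hpair n).monic_left, rfl, rfl, fun n hn => ?_⟩
  obtain ⟨k, rfl⟩ := Nat.exists_eq_add_of_le' hn
  exact (hpair k).painleveII_eq_zero

end Existence

section Picard

variable {R : Type*} [CommRing R] [Algebra ℂ R] (d : Derivation ℂ R R)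

/-- The map whose fixed points are the solutions of `(d + 2w) L_N[w' - w²] = t⁻¹w + α`. It is
contracting for the filtrations in which `t` has weight `1`. -/
noncomputable def picard (t α : R) (N : ℕ) (w : R) : R := t * (mkdv d N w - α)

variable {d} {t α : R} {N : ℕ}

theorem map_iterate_picard {R' : Type*} [CommRing R'] [Algebra ℂ R'] {d' : Derivation ℂ R' R'}
    {f : R →ₐ[ℂ] R'} (hf : ∀ a, f (d a) = d' (f a)) (j : ℕ) :
    f ((picard d t α N)^[j] 0) = (picard d' (f t) (f α) N)^[j] 0 := by
  have hsemi : Function.Semiconj f (picard d t α N) (picard d' (f t) (f α) N) := fun w => by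
    rw [picard, picard, map_mul, map_sub, map_mkdv hf]
  rw [(hsemi.iterate_right j).eq, map_zero]

variable {Φ : ℕ → Submodule ℂ R} [SetLike.GradedMonoid Φ]

theorem iterate_picard_mem (hd : ∀ ⦃i a⦄, a ∈ Φ i → d a ∈ Φ (i + 1))
    (hΦ : ∀ a ∈ Φ (2 * N + 1), t * (a - α) ∈ Φ 1) (j : ℕ) : (picard d t α N)^[j] 0 ∈ Φ 1 := by
  induction j with
  | zero => exact zero_mem _
  | succ j ih =>
    rw [Function.iterate_succ_apply']
    exact hΦ _ (mkdv_mem hd ih N)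

theorem sub_iterate_picard_mem (hd : ∀ ⦃i a⦄, a ∈ Φ i → d a ∈ Φ (i + 1))
    (hΦ : ∀ a ∈ Φ (2 * N + 1), t * (a - α) ∈ Φ 1) (ht : t ∈ Φ 1) {w : R} (hw : w ∈ Φ 1)
    (hfix : picard d t α N w = w) (j : ℕ) :
    w - (picard d t α N)^[j] 0 ∈ Φ ((2 * N + 1) * j + 1) := by
  induction j with
  | zero => simpa using hw
  | succ j ih =>
    have h := SetLike.mul_mem_graded ht (mkdv_sub_mem hd hw (iterate_picard_mem hd hΦ j) ih N)
    nth_rw 1 [Function.iterate_succ_apply', ← hfix, picard, picard, ← mul_sub,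
      sub_sub_sub_cancel_right]
    convert h using 2
    ring

end Picard

section Uniqueness

variable {N : ℕ} {α : ℂ} {w : RatFunc ℂ}

theorem picard_eq_self_of_painleveII_eq_zero (h : painleveII N w α = 0) :
    picard ratDeriv RatFunc.X⁻¹ (RatFunc.C α) N w = w := by
  rw [painleveII_eq_zero_iff] at h
  rw [picard, h, add_sub_cancel_right, inv_mul_cancel_left₀ RatFunc.X_ne_zero]

theorem inv_X_mul_sub_C_mem (N : ℕ) (α : ℂ) {f : RatFunc ℂ}
    (hf : f ∈ vanishAtInfty ((2 * N + 1 : ℕ) : ℤ)) :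
    RatFunc.X⁻¹ * (f - RatFunc.C α) ∈ vanishAtInfty ((1 : ℕ) : ℤ) := by
  have hf₀ := vanishAtInfty_antitone (Int.natCast_nonneg _) hf
  simpa using mul_mem_vanishAtInfty inv_X_mem_vanishAtInfty
    (sub_mem hf₀ (C_mem_vanishAtInfty α))

theorem sub_iterate_picard_mem_vanishAtInfty (hw : w ∈ vanishAtInfty 1)
    (h : painleveII N w α = 0) (j : ℕ) :
    w - (picard ratDeriv RatFunc.X⁻¹ (RatFunc.C α) N)^[j] 0 ∈
      vanishAtInfty (((2 * N + 1) * j + 1 : ℕ) : ℤ) :=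
  sub_iterate_picard_mem (Φ := fun k : ℕ => vanishAtInfty k) ratDeriv_mem_vanishAtInfty_natCast
    (fun _ => inv_X_mul_sub_C_mem N α) (mod_cast inv_X_mem_vanishAtInfty) (mod_cast hw)
    (picard_eq_self_of_painleveII_eq_zero h) j

theorem eq_of_painleveII_eq_zero {v : RatFunc ℂ} (hv : v ∈ vanishAtInfty 1)
    (hw : w ∈ vanishAtInfty 1) (hv₀ : painleveII N v α = 0) (hw₀ : painleveII N w α = 0) :
    v = w := by
  refine sub_eq_zero.1 (eq_zero_of_forall_mem_vanishAtInfty fun j => ?_)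
  have h := sub_mem (sub_iterate_picard_mem_vanishAtInfty hv hv₀ j)
    (sub_iterate_picard_mem_vanishAtInfty hw hw₀ j)
  rw [sub_sub_sub_cancel_right] at h
  exact vanishAtInfty_antitone (mod_cast by nlinarith) h

theorem eq_of_monic_of_derivative_div_eq {P Q : ℂ[X]} (hP : P.Monic) (hQ : Q.Monic)
    (h : algebraMap ℂ[X] (RatFunc ℂ) (derivative P) / algebraMap ℂ[X] (RatFunc ℂ) P =
      algebraMap ℂ[X] (RatFunc ℂ) (derivative Q) / algebraMap ℂ[X] (RatFunc ℂ) Q) : P = Q := by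
  have hP' := RatFunc.algebraMap_ne_zero hP.ne_zero
  have hQ' := RatFunc.algebraMap_ne_zero hQ.ne_zero
  have hquot : logDerivQuot P Q = 0 := by
    rw [logDerivQuot_eq hP.ne_zero hQ.ne_zero, h, sub_self]
  obtain ⟨c, hc⟩ := eq_C_of_ratDeriv_eq_zero
    ((div_eq_zero_iff.1 hquot).resolve_right (div_ne_zero hP' hQ'))
  rw [div_eq_iff hQ', ← RatFunc.algebraMap_C, ← map_mul] at hc
  have hPQ := RatFunc.algebraMap_injective ℂ hc
  have hlead := congrArg leadingCoeff hPQ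
  rw [leadingCoeff_mul, leadingCoeff_C, hP.leadingCoeff, hQ.leadingCoeff, mul_one] at hlead
  rw [hPQ, ← hlead, C_1, one_mul]

theorem IsYablonskiiVorobev.unique {Q Q' : ℕ → ℂ[X]} (h : IsYablonskiiVorobev N Q)
    (h' : IsYablonskiiVorobev N Q') : Q' = Q := by
  funext n
  induction n with
  | zero => rw [h.zero, h'.zero]
  | succ n ih =>
    have hsol := h.solution (n + 1) n.succ_pos
    have hsol' := h'.solution (n + 1) n.succ_pos
    rw [Nat.add_sub_cancel] at hsol hsol'
    rw [ih] at hsol'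
    have heq := eq_of_painleveII_eq_zero (logDerivQuot_mem _ _) (logDerivQuot_mem _ _) hsol hsol'
    rw [logDerivQuot_eq (h.monic n).ne_zero (h.monic _).ne_zero,
      logDerivQuot_eq (h.monic n).ne_zero (h'.monic _).ne_zero] at heq
    exact eq_of_monic_of_derivative_div_eq (h'.monic _) (h.monic _) (sub_right_injective heq).symm

end Uniqueness

section EvalInv

open RatFunc (inftyValuation)
open WithZero

variable {F : Type*} [Field F] {P Q T g : F[X]} {k m : ℕ}

/-- Substitution of `1/z` for the variable: polynomials as truncated expansions at infinity. -/
noncomputable def evalInv : F[X] →ₐ[F] RatFunc F := aeval (RatFunc.X⁻¹ : RatFunc F)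

theorem evalInv_X : evalInv (X : F[X]) = RatFunc.X⁻¹ := aeval_X _

theorem evalInv_C (c : F) : evalInv (C c) = RatFunc.C c := aeval_C _ _

theorem algebraMap_eq_evalInv_reflect_mul (h : P.natDegree ≤ m) :
    algebraMap F[X] (RatFunc F) P = evalInv (reflect m P) * RatFunc.X ^ m := by
  let _ : Invertible (RatFunc.X : RatFunc F) := invertibleOfNonzero RatFunc.X_ne_zero
  rw [← aeval_X_left_apply P, ← aeval_algebraMap_apply, RatFunc.algebraMap_X, aeval_X_left_apply]
  exact (eval₂_reflect_mul_pow (algebraMap F (RatFunc F)) RatFunc.X m P h).symm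

theorem evalInv_eq_algebraMap_reverse_mul (g : F[X]) :
    evalInv g = algebraMap F[X] (RatFunc F) g.reverse * (RatFunc.X ^ g.natDegree)⁻¹ := by
  let _ : Invertible (RatFunc.X⁻¹ : RatFunc F) :=
    invertibleOfNonzero (inv_ne_zero RatFunc.X_ne_zero)
  have h := eval₂_reverse_mul_pow (algebraMap F (RatFunc F)) RatFunc.X⁻¹ g
  rw [invOf_eq_inv, inv_inv, inv_pow] at h
  rw [← aeval_X_left_apply g.reverse, ← aeval_algebraMap_apply, RatFunc.algebraMap_X]
  exact h.symm

open Classical in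
theorem inftyValuation_evalInv (hg : g ≠ 0) :
    inftyValuation F (evalInv g) = exp (-(g.natTrailingDegree : ℤ)) := by
  rw [evalInv_eq_algebraMap_reverse_mul, map_mul, map_inv₀, map_pow, RatFunc.inftyValuation.X,
    RatFunc.inftyValuation_apply, RatFunc.inftyValuation.polynomial F (mt reverse_eq_zero.1 hg),
    reverse_natDegree, ← exp_nsmul, ← exp_neg, ← exp_add]
  have := natTrailingDegree_le_natDegree g
  congr 1
  simp only [nsmul_eq_mul, mul_one]
  lia

theorem evalInv_mem_vanishAtInfty : evalInv g ∈ vanishAtInfty (k : ℤ) ↔ X ^ k ∣ g := by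
  rcases eq_or_ne g 0 with rfl | hg
  · simp
  · rw [mem_vanishAtInfty, inftyValuation_evalInv hg, exp_le_exp, neg_le_neg_iff, Nat.cast_le,
      X_pow_dvd_iff]
    exact ⟨fun h i hi => coeff_eq_zero_of_lt_natTrailingDegree (hi.trans_le h),
      le_natTrailingDegree hg⟩

theorem coeff_reflect_X_mul_derivative (Q : F[X]) (k : ℕ) :
    (reflect Q.natDegree (X * derivative Q)).coeff k = (Q.natDegree - k) * Q.reverse.coeff k := by
  have hX (i : ℕ) : (X * derivative Q).coeff i = i * Q.coeff i := by
    cases i with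
    | zero => simp
    | succ i => rw [coeff_X_mul, coeff_derivative, Nat.cast_succ, mul_comm]
  rw [coeff_reflect, coeff_reverse, hX]
  rcases le_or_gt k Q.natDegree with hk | hk
  · rw [revAt_le hk, Nat.cast_sub hk]
  · rw [revAt_eq_self_of_lt hk, coeff_eq_zero_of_natDegree_lt hk, mul_zero, mul_zero]

theorem coeff_reverse_of_logDeriv_sub_mem (hQ : Q ≠ 0)
    (h : RatFunc.X * (algebraMap F[X] (RatFunc F) (derivative Q) / algebraMap F[X] (RatFunc F) Q)
      - evalInv T ∈ vanishAtInfty (m : ℤ)) (hk : k < m) :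
    (Q.natDegree - k) * Q.reverse.coeff k =
      ∑ x ∈ Finset.HasAntidiagonal.antidiagonal k, T.coeff x.1 * Q.reverse.coeff x.2 := by
  have hdeg : (X * derivative Q).natDegree ≤ Q.natDegree := by
    rcases eq_or_ne Q.natDegree 0 with h0 | h0
    · simp [derivative_of_natDegree_zero h0]
    · have := natDegree_derivative_lt h0
      have := natDegree_mul_le (p := X) (q := derivative Q)
      rw [natDegree_X] at this
      lia
  have hX := pow_ne_zero Q.natDegree (RatFunc.X_ne_zero (K := F))
  have hrev : algebraMap F[X] (RatFunc F) Q = evalInv Q.reverse * RatFunc.X ^ Q.natDegree :=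
    algebraMap_eq_evalInv_reflect_mul le_rfl
  have hrev₀ : evalInv Q.reverse ≠ 0 :=
    left_ne_zero_of_mul (hrev ▸ RatFunc.algebraMap_ne_zero hQ)
  have hlog : RatFunc.X * (algebraMap F[X] (RatFunc F) (derivative Q) /
      algebraMap F[X] (RatFunc F) Q) * evalInv Q.reverse =
        evalInv (reflect Q.natDegree (X * derivative Q)) := by
    rw [← mul_div_assoc, ← RatFunc.algebraMap_X, ← map_mul, algebraMap_eq_evalInv_reflect_mul hdeg,
      hrev, mul_div_mul_right _ _ hX]
    exact div_mul_cancel₀ _ hrev₀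
  have hdvd := mul_mem_vanishAtInfty h
    (evalInv_mem_vanishAtInfty.2 (by simp : X ^ 0 ∣ Q.reverse))
  rw [sub_mul, hlog, ← map_mul, ← map_sub, ← Nat.cast_add, evalInv_mem_vanishAtInfty,
    X_pow_dvd_iff] at hdvd
  rw [← coeff_mul, ← coeff_reflect_X_mul_derivative, ← sub_eq_zero, ← coeff_sub]
  exact hdvd k hk

end EvalInv

section Summation

variable {F : Type*} [Field F] [CharZero F] {P S : F[X]}

theorem exists_taylor_one_sub_eq (P : F[X]) : ∃ S : F[X], taylor 1 S - S = P := by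
  induction P using Polynomial.induction_on' with
  | add P P' h h' =>
    obtain ⟨S, rfl⟩ := h
    obtain ⟨S', rfl⟩ := h'
    exact ⟨S + S', by rw [map_add, add_sub_add_comm]⟩
  | monomial k a =>
    have hk : (k + 1 : F) ≠ 0 := Nat.cast_add_one_ne_zero k
    have hB : taylor 1 ((Polynomial.bernoulli (k + 1)).map (algebraMap ℚ F)) =
        (Polynomial.bernoulli (k + 1)).map (algebraMap ℚ F) + C (k + 1 : F) * X ^ k := by
      have h := congrArg (Polynomial.map (algebraMap ℚ F)) (bernoulli_comp_one_add_X (k + 1))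
      rw [Polynomial.map_comp, add_comm 1 X] at h
      simpa [taylor_apply] using h
    refine ⟨C (a / (k + 1)) * (Polynomial.bernoulli (k + 1)).map (algebraMap ℚ F), ?_⟩
    rw [taylor_mul, taylor_C, hB, ← mul_sub, add_sub_cancel_left, ← mul_assoc, ← C_mul,
      div_mul_cancel₀ _ hk, C_mul_X_pow_eq_monomial]

theorem iterate_fwdDiff_natDegree_ne_zero (hP : P ≠ 0) :
    (fwdDiff 1)^[P.natDegree] P.eval ≠ 0 := by
  rw [fwdDiff_iter_degree_eq_factorial]
  exact fun h => mul_ne_zero (leadingCoeff_ne_zero.2 hP)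
    (Nat.cast_ne_zero.2 P.natDegree.factorial_ne_zero) (congrFun h 0)

theorem natDegree_eq_of_taylor_one_sub_eq (h : taylor 1 S - S = P) (hP : P ≠ 0) :
    S.natDegree = P.natDegree + 1 := by
  have hdiff (n : ℕ) : (fwdDiff 1)^[n + 1] S.eval = (fwdDiff 1)^[n] P.eval := by
    rw [Function.iterate_succ_apply]
    congr 1
    funext x
    rw [fwdDiff, ← h, eval_sub, taylor_eval]
  rcases lt_trichotomy S.natDegree (P.natDegree + 1) with hlt | heq | hgt
  · refine absurd (hdiff P.natDegree ▸ ?_) (iterate_fwdDiff_natDegree_ne_zero hP)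
    exact fwdDiff_iter_eq_zero_of_degree_lt hlt
  · exact heq
  · obtain ⟨n, hn⟩ := Nat.exists_eq_add_of_le' (Nat.one_le_of_lt hgt)
    have hS : S ≠ 0 := ne_zero_of_natDegree_gt hgt
    refine absurd ?_ (iterate_fwdDiff_natDegree_ne_zero hS)
    rw [hn, hdiff]
    exact fwdDiff_iter_eq_zero_of_degree_lt (by lia)

theorem exists_eval_eq_sum_range (P : F[X]) :
    ∃ S : F[X], ∀ n : ℕ, S.eval (n : F) = ∑ i ∈ Finset.range n, P.eval ((i + 1 : ℕ) : F) := by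
  obtain ⟨S, hS⟩ := exists_taylor_one_sub_eq (taylor 1 P)
  refine ⟨S - C (S.eval 0), fun n => ?_⟩
  rw [eval_sub, eval_C, ← Nat.cast_zero, ← Finset.sum_range_sub fun i : ℕ => S.eval (i : F)]
  refine Finset.sum_congr rfl fun i _ => ?_
  rw [Nat.cast_succ, ← taylor_eval, ← taylor_eval, ← hS, eval_sub]

/-- The polynomial `S` such that `S(n) = P(1) + ⋯ + P(n)`. -/
noncomputable def sumPolynomial (P : F[X]) : F[X] := (exists_eval_eq_sum_range P).choose

theorem eval_sumPolynomial (P : F[X]) (n : ℕ) : (sumPolynomial P).eval (n : F) =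
    ∑ i ∈ Finset.range n, P.eval ((i + 1 : ℕ) : F) :=
  (exists_eval_eq_sum_range P).choose_spec n

theorem eq_of_eval_natCast_eq (h : ∀ n : ℕ, P.eval (n : F) = S.eval (n : F)) : P = S :=
  eq_of_infinite_eval_eq _ _ <| (Set.infinite_range_of_injective Nat.cast_injective).mono <| by
    rintro _ ⟨n, rfl⟩
    exact h n

theorem sumPolynomial_zero : sumPolynomial (0 : F[X]) = 0 :=
  eq_of_eval_natCast_eq fun n => by simp [eval_sumPolynomial]

theorem natDegree_sumPolynomial (hP : P ≠ 0) : (sumPolynomial P).natDegree = P.natDegree + 1 := by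
  rw [← natDegree_taylor P 1]
  refine natDegree_eq_of_taylor_one_sub_eq (eq_of_eval_natCast_eq fun n => ?_)
    ((taylor_eq_zero 1 P).not.2 hP)
  rw [eval_sub, taylor_eval, taylor_eval, ← Nat.cast_succ, eval_sumPolynomial, eval_sumPolynomial,
    Finset.sum_range_succ, add_sub_cancel_left]

end Summation

section NewtonCoeff

theorem mul_natDegree_sum_le {R ι : Type*} [Semiring R] {s : Finset ι} {f : ι → R[X]} {m b : ℕ}
    (h : ∀ i ∈ s, m * (f i).natDegree ≤ b) : m * (∑ i ∈ s, f i).natDegree ≤ b := by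
  refine Finset.sum_induction f (fun g => m * g.natDegree ≤ b) (fun g g' hg hg' => ?_) (by simp) h
  rcases max_choice g.natDegree g'.natDegree with hmax | hmax
  · exact (Nat.mul_le_mul_left m (hmax ▸ natDegree_add_le g g')).trans hg
  · exact (Nat.mul_le_mul_left m (hmax ▸ natDegree_add_le g g')).trans hg'

variable {F : Type*} [Field F]

/-- The solution of Newton's identities `k A_k + ∑_{i < k} A_i s_{k - i} = 0`: if `s k` is the sum
of the `k`-th powers of the roots of a monic polynomial, then `newtonCoeff s k` is its coefficient
`k` places below the leading one. -/
noncomputable def newtonCoeff (s : ℕ → F[X]) : ℕ → F[X]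
  | 0 => 1
  | k + 1 => C (-1 / (k + 1) : F) * ∑ i : Fin (k + 1), newtonCoeff s i * s (k + 1 - i)

theorem newtonCoeff_succ (s : ℕ → F[X]) (k : ℕ) : newtonCoeff s (k + 1) =
    C (-1 / (k + 1) : F) * ∑ i ∈ Finset.range (k + 1), newtonCoeff s i * s (k + 1 - i) := by
  rw [newtonCoeff, Fin.sum_univ_eq_sum_range fun i => newtonCoeff s i * s (k + 1 - i)]

variable {s : ℕ → F[X]} {k l p q : ℕ}

theorem eq_eval_newtonCoeff [CharZero F] {a : ℕ → F} {m : ℕ} {x : F} (ha : a 0 = 1)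
    (h : ∀ k < m, ((s 0).eval x - k) * a k =
      ∑ y ∈ Finset.HasAntidiagonal.antidiagonal k, (s y.1).eval x * a y.2)
    (hk : k < m) : a k = (newtonCoeff s k).eval x := by
  induction k using Nat.strong_induction_on with
  | _ k ih =>
    cases k with
    | zero => rw [ha, newtonCoeff, eval_one]
    | succ k =>
      have hrec := h (k + 1) hk
      rw [← Finset.Nat.sum_antidiagonal_swap, Finset.Nat.sum_antidiagonal_eq_sum_range_succ_mk,
        Finset.sum_range_succ] at hrec
      simp only [Prod.swap_prod_mk, Nat.sub_self, Nat.cast_succ] at hrec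
      have hsum : (∑ i ∈ Finset.range (k + 1), newtonCoeff s i * s (k + 1 - i)).eval x =
          ∑ i ∈ Finset.range (k + 1), (s (k + 1 - i)).eval x * a i := by
        rw [eval_finsetSum]
        refine Finset.sum_congr rfl fun i hi => ?_
        have hik := Finset.mem_range.1 hi
        rw [eval_mul, ih i hik (hik.trans hk), mul_comm]
      have hk₀ : (k + 1 : F) ≠ 0 := Nat.cast_add_one_ne_zero k
      rw [newtonCoeff_succ, eval_mul, eval_C, hsum]
      field_simp
      linear_combination -hrec

theorem mul_natDegree_newtonCoeff_le (hs : ∀ i ≠ 0, p * (s i).natDegree ≤ q * i) (k : ℕ) :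
    p * (newtonCoeff s k).natDegree ≤ q * k := by
  induction k using Nat.strong_induction_on with
  | _ k ih =>
    cases k with
    | zero => simp [newtonCoeff]
    | succ k =>
      rw [newtonCoeff_succ]
      refine (Nat.mul_le_mul_left p (natDegree_C_mul_le _ _)).trans
        (mul_natDegree_sum_le fun i hi => ?_)
      have hik := Finset.mem_range.1 hi
      calc p * (newtonCoeff s i * s (k + 1 - i)).natDegree
          ≤ p * (newtonCoeff s i).natDegree + p * (s (k + 1 - i)).natDegree := by
            rw [← mul_add]
            exact Nat.mul_le_mul_left p natDegree_mul_le
        _ ≤ q * i + q * (k + 1 - i) := add_le_add (ih i hik) (hs _ (by lia))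
        _ = q * (k + 1) := by rw [← mul_add, Nat.add_sub_cancel' hik.le]

theorem coeff_newtonCoeff_mul_ne_zero [CharZero F] (hp : p ≠ 0)
    (hsp : (s p).natDegree = q) (hsp₀ : s p ≠ 0) (hs : ∀ i ≠ 0, p * (s i).natDegree ≤ q * i)
    (hs' : ∀ i ≠ 0, i ≠ p → s i ≠ 0 → p * (s i).natDegree ≠ q * i) (l : ℕ) :
    (newtonCoeff s (p * l)).coeff (q * l) ≠ 0 := by
  induction l with
  | zero => simp [newtonCoeff]
  | succ l ih =>
    have hA (i : ℕ) := mul_natDegree_newtonCoeff_le hs i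
    obtain ⟨k, hk⟩ := Nat.exists_eq_succ_of_ne_zero (mul_ne_zero hp l.succ_ne_zero)
    have hkl : p * l + p = k + 1 := hk
    have hk₀ : (-1 / (k + 1) : F) ≠ 0 :=
      div_ne_zero (neg_ne_zero.2 one_ne_zero) (Nat.cast_add_one_ne_zero k)
    rw [hk, Nat.succ_eq_add_one, newtonCoeff_succ, coeff_C_mul, finsetSum_coeff,
      Finset.sum_eq_single_of_mem (p * l) (Finset.mem_range.2 (by lia))]
    · have hl : (newtonCoeff s (p * l)).natDegree ≤ q * l :=
        Nat.le_of_mul_le_mul_left ((hA _).trans_eq (mul_left_comm q p l)) (Nat.pos_of_ne_zero hp)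
      rw [← hkl, Nat.add_sub_cancel_left, mul_add_one,
        coeff_mul_add_eq_of_natDegree_le hl hsp.le, ← hsp, coeff_natDegree]
      exact mul_ne_zero hk₀ (mul_ne_zero (hsp ▸ ih) (leadingCoeff_ne_zero.2 hsp₀))
    · intro i hi hil
      have hik := Finset.mem_range.1 hi
      rcases eq_or_ne (s (k + 1 - i)) 0 with h₀ | h₀
      · rw [h₀, mul_zero, coeff_zero]
      refine coeff_eq_zero_of_natDegree_lt (Nat.lt_of_mul_lt_mul_left (a := p) ?_)
      calc p * (newtonCoeff s i * s (k + 1 - i)).natDegree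
          ≤ p * (newtonCoeff s i).natDegree + p * (s (k + 1 - i)).natDegree := by
            rw [← mul_add]
            exact Nat.mul_le_mul_left p natDegree_mul_le
        _ < q * i + q * (k + 1 - i) :=
            add_lt_add_of_le_of_lt (hA i)
              ((hs _ (by lia)).lt_of_ne (hs' _ (by lia) (by lia) h₀))
        _ = p * (q * (l + 1)) := by
            rw [← mul_add, Nat.add_sub_cancel' hik.le, mul_left_comm p, hk]

theorem natDegree_newtonCoeff_mul [CharZero F] (hp : p ≠ 0)
    (hsp : (s p).natDegree = q) (hsp₀ : s p ≠ 0) (hs : ∀ i ≠ 0, p * (s i).natDegree ≤ q * i)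
    (hs' : ∀ i ≠ 0, i ≠ p → s i ≠ 0 → p * (s i).natDegree ≠ q * i) (l : ℕ) :
    (newtonCoeff s (p * l)).natDegree = q * l := by
  refine le_antisymm (Nat.le_of_mul_le_mul_left ?_ (Nat.pos_of_ne_zero hp))
    (le_natDegree_of_ne_zero (coeff_newtonCoeff_mul_ne_zero hp hsp hsp₀ hs hs' l))
  exact (mul_natDegree_newtonCoeff_le hs _).trans_eq (mul_left_comm q p l)

end NewtonCoeff

section InvDeriv

variable (A : Type*) [CommRing A] [Algebra ℂ A]

/-- The derivation `d/dz` on polynomials in `X = 1/z`. -/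
noncomputable def invDeriv : Derivation ℂ A[X] A[X] :=
  (mkDerivation A (-X ^ 2 : A[X])).restrictScalars ℂ

variable {A}

theorem invDeriv_apply (f : A[X]) : invDeriv A f = -(X ^ 2 * derivative f) := by
  rw [invDeriv, Derivation.restrictScalars_apply, mkDerivation_apply, smul_eq_mul, mul_neg,
    mul_comm]

theorem invDeriv_C_mul_X_pow (a : A) (n : ℕ) :
    invDeriv A (C a * X ^ n) = C (-(n : A) * a) * X ^ (n + 1) := by
  rw [invDeriv_apply, derivative_C_mul_X_pow]
  cases n with
  | zero => simp
  | succ n =>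
    simp only [C_mul, C_neg, Nat.add_sub_cancel, map_natCast]
    ring

theorem coeff_invDeriv_zero (f : A[X]) : (invDeriv A f).coeff 0 = 0 := by
  rw [invDeriv_apply, coeff_neg, coeff_X_pow_mul', if_neg (by norm_num), neg_zero]

theorem coeff_invDeriv_succ (f : A[X]) (i : ℕ) :
    (invDeriv A f).coeff (i + 1) = -(i * f.coeff i) := by
  rw [invDeriv_apply, coeff_neg, coeff_X_pow_mul']
  cases i with
  | zero => simp
  | succ i =>
    rw [if_pos (by lia), Nat.succ_sub_succ, Nat.succ_sub_one, coeff_derivative]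
    push_cast
    ring

theorem eq_of_invDeriv_eq [IsDomain A] [CharZero A] {f g : A[X]}
    (h : invDeriv A f = invDeriv A g) (h₀ : f.coeff 0 = g.coeff 0) : f = g := by
  ext1 i
  cases i with
  | zero => exact h₀
  | succ i =>
    have hi := congrArg (coeff · (i + 2)) h
    simp only [coeff_invDeriv_succ] at hi
    exact mul_left_cancel₀ (Nat.cast_ne_zero.2 i.succ_ne_zero) (neg_injective hi)

theorem ratDeriv_evalInv (g : ℂ[X]) : ratDeriv (evalInv g) = evalInv (invDeriv ℂ g) := by
  rw [evalInv, Derivation.map_aeval, ← evalInv, Derivation.leibniz_inv, ratDeriv_X,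
    invDeriv_apply, map_neg, map_mul, map_pow, evalInv_X]
  simp only [smul_eq_mul]
  ring

variable (A) in
/-- The multiples of `X ^ e`, as filtration of `A[X]`. -/
noncomputable def xDivisible (e : ℕ) : Submodule ℂ A[X] :=
  (Ideal.span {(X : A[X]) ^ e}).restrictScalars ℂ

theorem mem_xDivisible {e : ℕ} {f : A[X]} : f ∈ xDivisible A e ↔ X ^ e ∣ f :=
  Ideal.mem_span_singleton

instance xDivisible.gradedMonoid : SetLike.GradedMonoid (xDivisible A) where
  one_mem := mem_xDivisible.2 (by rw [pow_zero])
  mul_mem i j f g hf hg := by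
    rw [mem_xDivisible, pow_add]
    exact mul_dvd_mul (mem_xDivisible.1 hf) (mem_xDivisible.1 hg)

theorem invDeriv_mem_xDivisible ⦃e : ℕ⦄ ⦃f : A[X]⦄ (hf : f ∈ xDivisible A e) :
    invDeriv A f ∈ xDivisible A (e + 1) := by
  rw [mem_xDivisible, X_pow_dvd_iff] at hf ⊢
  intro i hi
  cases i with
  | zero => exact coeff_invDeriv_zero f
  | succ i => rw [coeff_invDeriv_succ, hf i (by lia), mul_zero, neg_zero]

/-- The element of `A` such that `L_k[a / z²] = lenardCoeff a k / z ^ (2k)`. -/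
noncomputable def lenardCoeff (a : A) : ℕ → A
  | 0 => algebraMap ℂ A (1 / 2)
  | k + 1 => algebraMap ℂ A (2 * (2 * k + 1) / (k + 1)) * (k * (k + 1) + a) * lenardCoeff a k

theorem add_one_mul_lenardCoeff_succ (a : A) (k : ℕ) : (k + 1) * lenardCoeff a (k + 1) =
    2 * (2 * k + 1) * (k * (k + 1) + a) * lenardCoeff a k := by
  have hk : ((k : A) + 1) * algebraMap ℂ A (2 * (2 * k + 1) / (k + 1)) = 2 * (2 * k + 1) := by
    have h := congrArg (algebraMap ℂ A)
      (mul_div_cancel₀ (2 * (2 * (k : ℂ) + 1)) (Nat.cast_add_one_ne_zero k))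
    simpa only [map_mul, map_add, map_natCast, map_one, map_ofNat] using h
  rw [lenardCoeff]
  linear_combination (k * (k + 1) + a) * lenardCoeff a k * hk

theorem lenard_C_mul_X_sq [IsDomain A] [CharZero A] (a : A) (k : ℕ) :
    lenard (invDeriv A) (C a * X ^ 2) k = C (lenardCoeff a k) * X ^ (2 * k) := by
  induction k with
  | zero => rw [lenard_zero, lenardCoeff, mul_zero, pow_zero, mul_one]; rfl
  | succ k ih =>
    refine eq_of_invDeriv_eq ?_ ?_
    · have hrec := congrArg C (add_one_mul_lenardCoeff_succ a k)
      rw [lenard_recursion, ih]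
      simp only [invDeriv_C_mul_X_pow]
      simp only [map_mul, map_add, map_neg, map_natCast, map_one, map_ofNat] at hrec ⊢
      push_cast
      linear_combination 2 * X ^ (2 * k + 3) * hrec
    · have h := lenard_mem invDeriv_mem_xDivisible
        (mem_xDivisible.2 (Dvd.intro_left (C a) rfl)) (k + 1)
      rw [mem_xDivisible, X_pow_dvd_iff] at h
      rw [h 0 (by lia), coeff_C_mul_X_pow, if_neg (by lia)]

theorem mkdv_C_mul_X [IsDomain A] [CharZero A] (a : A) (N : ℕ) : mkdv (invDeriv A) N (C a * X) =
    C (2 * (a - N) * lenardCoeff (-a - a ^ 2) N) * X ^ (2 * N + 1) := by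
  have hderiv : invDeriv A (C a * X) = C (-a) * X ^ 2 := by
    simpa only [pow_one, Nat.cast_one, neg_one_mul] using invDeriv_C_mul_X_pow a 1
  have hu : invDeriv A (C a * X) - (C a * X) ^ 2 = C (-a - a ^ 2) * X ^ 2 := by
    rw [hderiv, C_sub, C_pow]
    ring
  rw [mkdv, hu, lenard_C_mul_X_sq, invDeriv_C_mul_X_pow]
  simp only [map_mul, map_neg, map_sub, map_natCast, map_ofNat]
  push_cast
  ring

theorem degree_lenardCoeff {a : ℂ[X]} (ha : a.natDegree ≠ 0) (k : ℕ) :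
    (lenardCoeff a k).degree = (a.natDegree * k : ℕ) := by
  induction k with
  | zero => exact degree_C (by norm_num)
  | succ k ih =>
    have hc : (2 * (2 * k + 1) / (k + 1) : ℂ) ≠ 0 :=
      mod_cast div_ne_zero (Nat.cast_ne_zero.2 (by lia : 2 * (2 * k + 1) ≠ 0))
        (Nat.cast_ne_zero.2 k.succ_ne_zero)
    have ha' : 0 < a.degree := natDegree_pos_iff_degree_pos.1 (Nat.pos_of_ne_zero ha)
    have hfactor : (k * (k + 1) + a : ℂ[X]).degree = a.natDegree := by
      have h := degree_add_C (a := (k * (k + 1) : ℂ)) ha'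
      simp only [map_mul, map_add, map_natCast, map_one] at h
      rw [add_comm, h, degree_eq_natDegree (ne_zero_of_degree_gt ha')]
    rw [lenardCoeff, algebraMap_eq, degree_mul, degree_mul, degree_C hc, hfactor, ih, zero_add,
      ← Nat.cast_add, mul_add_one, add_comm]

end InvDeriv

section FormalSolution

/-- Substitution of `1/z` for the variable and of `c` for the variable of the coefficients. -/
noncomputable def evalBiv (c : ℂ) : ℂ[X][X] →ₐ[ℂ] RatFunc ℂ :=
  evalInv.comp (mapAlgHom (aeval c))

theorem evalBiv_apply (c : ℂ) (f : ℂ[X][X]) : evalBiv c f = evalInv (f.map (evalRingHom c)) := rfl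

theorem evalBiv_X (c : ℂ) : evalBiv c X = RatFunc.X⁻¹ := by
  rw [evalBiv_apply, map_X, evalInv_X]

theorem evalBiv_C_X (c : ℂ) : evalBiv c (C X) = RatFunc.C c := by
  rw [evalBiv_apply, map_C, coe_evalRingHom, eval_X, evalInv_C]

theorem evalBiv_invDeriv (c : ℂ) (f : ℂ[X][X]) :
    evalBiv c (invDeriv ℂ[X] f) = ratDeriv (evalBiv c f) := by
  rw [evalBiv_apply, evalBiv_apply, ratDeriv_evalInv, invDeriv_apply, invDeriv_apply]
  simp only [Polynomial.map_mul, Polynomial.map_neg, Polynomial.map_pow, map_X, derivative_map]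

/-- Approximations of the formal solution at infinity of `P_2^{(N)}[w, α]`, as polynomials in `1/z`
with coefficients in `ℂ[α]`. -/
noncomputable def formalSolution (N j : ℕ) : ℂ[X][X] := (picard (invDeriv ℂ[X]) X (C X) N)^[j] 0

/-- Approximations of `z w`, where `w` is the formal solution at infinity. -/
noncomputable def scaledSolution (N j : ℕ) : ℂ[X][X] :=
  mkdv (invDeriv ℂ[X]) N (formalSolution N j) - C X

theorem formalSolution_succ (N j : ℕ) : formalSolution N (j + 1) = X * scaledSolution N j :=
  Function.iterate_succ_apply' _ _ _

theorem evalBiv_formalSolution (c : ℂ) (N j : ℕ) : evalBiv c (formalSolution N j) =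
    (picard ratDeriv RatFunc.X⁻¹ (RatFunc.C c) N)^[j] 0 := by
  rw [formalSolution, map_iterate_picard (evalBiv_invDeriv c), evalBiv_X, evalBiv_C_X]

theorem X_mul_sub_evalBiv_scaledSolution_mem {N : ℕ} {w : RatFunc ℂ} {c : ℂ}
    (hw : w ∈ vanishAtInfty 1) (h : painleveII N w c = 0) (j : ℕ) :
    RatFunc.X * w - evalBiv c (scaledSolution N j) ∈
      vanishAtInfty (((2 * N + 1) * (j + 1) : ℕ) : ℤ) := by
  have hmem := mul_mem_vanishAtInfty X_mem_vanishAtInfty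
    (sub_iterate_picard_mem_vanishAtInfty hw h (j + 1))
  rw [← evalBiv_formalSolution, formalSolution_succ, map_mul, evalBiv_X, mul_sub,
    mul_inv_cancel_left₀ RatFunc.X_ne_zero] at hmem
  convert hmem using 2
  push_cast
  ring

variable {N i : ℕ}

theorem formalSolution_mem_xDivisible (N j : ℕ) : formalSolution N j ∈ xDivisible ℂ[X] 1 :=
  iterate_picard_mem invDeriv_mem_xDivisible
    (fun _ _ => mem_xDivisible.2 (by rw [pow_one]; exact Dvd.intro _ rfl)) j

theorem mkdv_formalSolution_mem_xDivisible (N j : ℕ) :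
    mkdv (invDeriv ℂ[X]) N (formalSolution N j) ∈ xDivisible ℂ[X] (2 * N + 1) :=
  mkdv_mem invDeriv_mem_xDivisible (formalSolution_mem_xDivisible N j) N

theorem coeff_scaledSolution_zero (N j : ℕ) : (scaledSolution N j).coeff 0 = -X := by
  have h := mem_xDivisible.1 (mkdv_formalSolution_mem_xDivisible N j)
  rw [scaledSolution, coeff_sub, X_pow_dvd_iff.1 h 0 (by lia), coeff_C_zero, zero_sub]

theorem coeff_scaledSolution_of_lt (j : ℕ) (h₀ : i ≠ 0) (hi : i < 2 * N + 1) :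
    (scaledSolution N j).coeff i = 0 := by
  have h := mem_xDivisible.1 (mkdv_formalSolution_mem_xDivisible N j)
  rw [scaledSolution, coeff_sub, X_pow_dvd_iff.1 h i hi, coeff_C_of_ne_zero h₀, sub_zero]

theorem formalSolution_succ_sub_mem_xDivisible (N j : ℕ) :
    formalSolution N (j + 1) - C (-X) * X ∈ xDivisible ℂ[X] (2 * N + 2) := by
  have h : formalSolution N (j + 1) - C (-X) * X =
      X * mkdv (invDeriv ℂ[X]) N (formalSolution N j) := by
    rw [formalSolution_succ, scaledSolution, C_neg]
    ring
  rw [h, mem_xDivisible, pow_succ']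
  exact mul_dvd_mul_left X (mem_xDivisible.1 (mkdv_formalSolution_mem_xDivisible N j))

theorem coeff_scaledSolution_succ (N j : ℕ) : (scaledSolution N (j + 1)).coeff (2 * N + 1) =
    2 * (-X - (N : ℂ[X])) * lenardCoeff (X - X ^ 2) N := by
  have hX : (C (-X) * X : ℂ[X][X]) ∈ xDivisible ℂ[X] 1 :=
    mem_xDivisible.2 (by rw [pow_one]; exact Dvd.intro_left _ rfl)
  have h := mkdv_sub_mem invDeriv_mem_xDivisible (formalSolution_mem_xDivisible N (j + 1)) hX
    (formalSolution_succ_sub_mem_xDivisible N j) N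
  have hcoeff := X_pow_dvd_iff.1 (mem_xDivisible.1 h) (2 * N + 1) (by lia)
  rw [coeff_sub, mkdv_C_mul_X, coeff_C_mul_X_pow, if_pos rfl, sub_eq_zero] at hcoeff
  rw [scaledSolution, coeff_sub, coeff_C_of_ne_zero (by lia), sub_zero, hcoeff, neg_neg, neg_sq]

theorem degree_coeff_scaledSolution_succ (N j : ℕ) :
    ((scaledSolution N (j + 1)).coeff (2 * N + 1)).degree = (2 * N + 1 : ℕ) := by
  have hquad : (X - X ^ 2 : ℂ[X]).natDegree = 2 := by compute_degree!
  have hlin : (2 * (-X - (N : ℂ[X]))).degree = 1 := by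
    have h : (2 * (-X - (N : ℂ[X]))) = C (-2) * (X + C (N : ℂ)) := by
      simp only [map_neg, map_ofNat, map_natCast]
      ring
    rw [h, degree_C_mul (by norm_num), degree_X_add_C]
  rw [coeff_scaledSolution_succ, degree_mul, hlin,
    degree_lenardCoeff (by rw [hquad]; exact two_ne_zero), hquad, add_comm]
  rfl

/-- Polynomials in `1/z` whose coefficient of `z⁻ⁱ` has degree at most `(e + 2 N i) / (2 N + 1)` in
`α`. The approximate formal solutions satisfy this bound with `e = 1`. -/
noncomputable def degreeBounded (N e : ℕ) : Submodule ℂ ℂ[X][X] where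
  carrier := {f | ∀ i, (2 * N + 1) * (f.coeff i).natDegree ≤ e + 2 * N * i}
  zero_mem' := by simp
  smul_mem' c f hf i := by
    rw [coeff_smul]
    exact (Nat.mul_le_mul_left _ (natDegree_smul_le c _)).trans (hf i)
  add_mem' {f g} hf hg i := by
    rw [coeff_add]
    rcases le_max_iff.1 (natDegree_add_le (f.coeff i) (g.coeff i)) with h | h
    · exact (Nat.mul_le_mul_left _ h).trans (hf i)
    · exact (Nat.mul_le_mul_left _ h).trans (hg i)

theorem mem_degreeBounded {e : ℕ} {f : ℂ[X][X]} : f ∈ degreeBounded N e ↔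
    ∀ i, (2 * N + 1) * (f.coeff i).natDegree ≤ e + 2 * N * i :=
  Iff.rfl

theorem C_mem_degreeBounded {e : ℕ} {a : ℂ[X]} (ha : (2 * N + 1) * a.natDegree ≤ e) :
    C a ∈ degreeBounded N e := fun i => by
  rw [coeff_C]
  split_ifs with hi
  · exact ha.trans (Nat.le_add_right _ _)
  · simp

instance degreeBounded.gradedMonoid (N : ℕ) : SetLike.GradedMonoid (degreeBounded N) where
  one_mem := C_1 (R := ℂ[X]) ▸ C_mem_degreeBounded (by simp)
  mul_mem i j f g hf hg k := by
    rw [coeff_mul]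
    refine mul_natDegree_sum_le fun x hx => ?_
    have hmul := Nat.mul_le_mul_left (2 * N + 1)
      (natDegree_mul_le (p := f.coeff x.1) (q := g.coeff x.2))
    rw [mul_add] at hmul
    have hf' := hf x.1
    have hg' := hg x.2
    rw [← Finset.HasAntidiagonal.mem_antidiagonal.1 hx, mul_add]
    lia

theorem invDeriv_mem_degreeBounded ⦃e : ℕ⦄ ⦃f : ℂ[X][X]⦄ (hf : f ∈ degreeBounded N e) :
    invDeriv ℂ[X] f ∈ degreeBounded N (e + 1) := fun i => by
  cases i with
  | zero => simp [coeff_invDeriv_zero]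
  | succ i =>
    have hcoeff : (-(i * f.coeff i) : ℂ[X]).natDegree ≤ (f.coeff i).natDegree := by
      rw [natDegree_neg, ← C_eq_natCast]
      exact natDegree_C_mul_le _ _
    have hmul := (Nat.mul_le_mul_left (2 * N + 1) hcoeff).trans (hf i)
    rw [coeff_invDeriv_succ, mul_add]
    lia

theorem X_mul_mem_degreeBounded {f : ℂ[X][X]} (hf : f ∈ degreeBounded N (2 * N + 1)) :
    X * f ∈ degreeBounded N 1 := fun i => by
  cases i with
  | zero => simp
  | succ i =>
    have hi := hf i
    rw [coeff_X_mul, mul_add]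
    lia

theorem C_X_mem_degreeBounded (N : ℕ) : (C X : ℂ[X][X]) ∈ degreeBounded N (2 * N + 1) :=
  C_mem_degreeBounded (by rw [natDegree_X, mul_one])

theorem scaledSolution_mem_degreeBounded (N j : ℕ) :
    scaledSolution N j ∈ degreeBounded N (2 * N + 1) := by
  have hj : formalSolution N j ∈ degreeBounded N 1 :=
    iterate_picard_mem invDeriv_mem_degreeBounded
      (fun f hf => X_mul_mem_degreeBounded (sub_mem hf (C_X_mem_degreeBounded N))) j
  exact sub_mem (mkdv_mem invDeriv_mem_degreeBounded hj N) (C_X_mem_degreeBounded N)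

end FormalSolution

section PowerSums

variable {N : ℕ}

/-- Polynomials in `n` whose values are the sums of the `k`-th powers of the roots of `Q_n`, for
`k < (2N + 1)(j + 1)`: the coefficients of the expansion at infinity of `z Q_n' / Q_n`. -/
noncomputable def powerSum (N j k : ℕ) : ℂ[X] := sumPolynomial (-(scaledSolution N j).coeff k)

theorem eval_powerSum (N j k n : ℕ) : (powerSum N j k).eval (n : ℂ) =
    -∑ i ∈ Finset.range n, ((scaledSolution N j).coeff k).eval ((i + 1 : ℕ) : ℂ) := by
  simp only [powerSum, eval_sumPolynomial, eval_neg, Finset.sum_neg_distrib]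

theorem powerSum_of_lt {i : ℕ} (j : ℕ) (h₀ : i ≠ 0) (hi : i < 2 * N + 1) : powerSum N j i = 0 := by
  rw [powerSum, coeff_scaledSolution_of_lt j h₀ hi, neg_zero, sumPolynomial_zero]

theorem natDegree_powerSum_succ (N j : ℕ) :
    (powerSum N (j + 1) (2 * N + 1)).natDegree = 2 * N + 2 := by
  have hdeg := degree_coeff_scaledSolution_succ N j
  have hne : (scaledSolution N (j + 1)).coeff (2 * N + 1) ≠ 0 := fun h =>
    WithBot.bot_ne_natCast _ (by rwa [h, degree_zero] at hdeg)
  rw [powerSum, natDegree_sumPolynomial (neg_ne_zero.2 hne), natDegree_neg,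
    natDegree_eq_of_degree_eq_some hdeg]

theorem mul_natDegree_powerSum_le (N j i : ℕ) :
    (2 * N + 1) * (powerSum N j i).natDegree ≤ 2 * (2 * N + 1) + 2 * N * i := by
  rcases eq_or_ne ((scaledSolution N j).coeff i) 0 with h | h
  · simp [powerSum, h, sumPolynomial_zero]
  · have hi := mem_degreeBounded.1 (scaledSolution_mem_degreeBounded N j) i
    rw [powerSum, natDegree_sumPolynomial (neg_ne_zero.2 h), natDegree_neg, mul_add_one]
    lia

theorem mul_natDegree_powerSum_lt {i : ℕ} (j : ℕ) (h₀ : i ≠ 0) (hi : i ≠ 2 * N + 1)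
    (h : powerSum N j i ≠ 0) :
    (2 * N + 1) * (powerSum N j i).natDegree < (2 * N + 2) * i := by
  rcases hi.lt_or_gt with hlt | hgt
  · exact absurd (powerSum_of_lt j h₀ hlt) h
  · refine (mul_natDegree_powerSum_le N j i).trans_lt ?_
    rw [add_mul]
    lia

theorem natDegree_newtonCoeff_powerSum (N j l : ℕ) :
    (newtonCoeff (powerSum N (j + 1)) ((2 * N + 1) * l)).natDegree = (2 * N + 2) * l := by
  have hdeg := natDegree_powerSum_succ N j
  have hne : powerSum N (j + 1) (2 * N + 1) ≠ 0 := ne_zero_of_natDegree_gt (n := 0) (by lia)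
  refine natDegree_newtonCoeff_mul (by lia) hdeg hne (fun i hi => ?_)
    (fun i h₀ hi h => (mul_natDegree_powerSum_lt (j + 1) h₀ hi h).ne) l
  rcases eq_or_ne i (2 * N + 1) with rfl | hi'
  · rw [hdeg, mul_comm]
  · rcases eq_or_ne (powerSum N (j + 1) i) 0 with h | h
    · simp [h]
    · exact (mul_natDegree_powerSum_lt (j + 1) hi hi' h).le

namespace IsYablonskiiVorobev

variable {Q : ℕ → ℂ[X]}

theorem X_mul_logDeriv_add_sum_mem (h : IsYablonskiiVorobev N Q) (j n : ℕ) :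
    RatFunc.X * (algebraMap ℂ[X] (RatFunc ℂ) (derivative (Q n)) /
      algebraMap ℂ[X] (RatFunc ℂ) (Q n)) +
        ∑ i ∈ Finset.range n, evalBiv ((i + 1 : ℕ) : ℂ) (scaledSolution N j) ∈
      vanishAtInfty (((2 * N + 1) * (j + 1) : ℕ) : ℤ) := by
  induction n with
  | zero => simp [h.zero]
  | succ n ih =>
    have hsol := h.solution (n + 1) n.succ_pos
    rw [Nat.add_sub_cancel] at hsol
    have hmem := X_mul_sub_evalBiv_scaledSolution_mem (logDerivQuot_mem _ _) hsol j
    rw [logDerivQuot_eq (h.monic n).ne_zero (h.monic (n + 1)).ne_zero] at hmem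
    convert sub_mem ih hmem using 1
    rw [Finset.sum_range_succ]
    ring

theorem newton_identity (h : IsYablonskiiVorobev N Q) (n : ℕ) {j k : ℕ}
    (hk : k < (2 * N + 1) * (j + 1)) :
    ((Q n).natDegree - k) * (Q n).reverse.coeff k =
      ∑ x ∈ Finset.HasAntidiagonal.antidiagonal k,
        (powerSum N j x.1).eval (n : ℂ) * (Q n).reverse.coeff x.2 := by
  have hcoeff (k : ℕ) : (powerSum N j k).eval (n : ℂ) =
      (-∑ i ∈ Finset.range n,
        (scaledSolution N j).map (evalRingHom ((i + 1 : ℕ) : ℂ))).coeff k := by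
    simp only [eval_powerSum, coeff_neg, finsetSum_coeff, coeff_map, coe_evalRingHom]
  simp only [hcoeff]
  refine coeff_reverse_of_logDeriv_sub_mem (h.monic n).ne_zero ?_ hk
  rw [map_neg, map_sum, sub_neg_eq_add]
  exact h.X_mul_logDeriv_add_sum_mem j n

theorem coeff_reverse_zero (h : IsYablonskiiVorobev N Q) (n : ℕ) : (Q n).reverse.coeff 0 = 1 := by
  rw [coeff_zero_reverse, (h.monic n).leadingCoeff]

theorem natDegree_eq_eval_powerSum (h : IsYablonskiiVorobev N Q) (j n : ℕ) :
    ((Q n).natDegree : ℂ) = (powerSum N j 0).eval (n : ℂ) := by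
  have h₀ := h.newton_identity n (j := j) (k := 0) (by positivity)
  rwa [Finset.HasAntidiagonal.antidiagonal_zero, Finset.sum_singleton, h.coeff_reverse_zero,
    mul_one, mul_one, Nat.cast_zero, sub_zero] at h₀

theorem natDegree_mul_two (h : IsYablonskiiVorobev N Q) (n : ℕ) :
    (Q n).natDegree * 2 = (n + 1) * n := by
  have hdeg := h.natDegree_eq_eval_powerSum 0 n
  simp only [eval_powerSum, coeff_scaledSolution_zero, eval_neg, eval_X, Finset.sum_neg_distrib,
    neg_neg] at hdeg
  have hsum : (Q n).natDegree = ∑ i ∈ Finset.range (n + 1), i := by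
    rw [Finset.sum_range_succ', add_zero]
    exact_mod_cast hdeg
  rw [hsum, Finset.sum_range_id_mul_two, Nat.add_sub_cancel]

theorem coeff_reverse_eq (h : IsYablonskiiVorobev N Q) (n : ℕ) {j k : ℕ}
    (hk : k < (2 * N + 1) * (j + 1)) :
    (Q n).reverse.coeff k = (newtonCoeff (powerSum N j) k).eval (n : ℂ) :=
  eq_eval_newtonCoeff (h.coeff_reverse_zero n)
    (fun _ hi => h.natDegree_eq_eval_powerSum j n ▸ h.newton_identity n hi) hk

end IsYablonskiiVorobev

end PowerSums

section Divisibility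

theorem lt_of_lt_nZero {N l n : ℕ} (h : n < nZero N l) : (n + 1) * n < 2 * ((2 * N + 1) * l) := by
  rw [nZero, Nat.lt_ceil, lt_sub_iff_add_lt] at h
  have hsq := (Real.lt_sqrt (by positivity)).1 h
  have hlt : ((n + 1) * n : ℝ) < 2 * ((2 * N + 1) * l) := by linarith
  exact_mod_cast hlt

theorem polyT_dvd {m : ℕ} {P : ℂ[X]} (h : ∀ n < m, P.eval (n : ℂ) = 0) : polyT m ∣ P := by
  refine Finset.prod_dvd_of_coprime (fun i _ j _ hij => ?_) fun i hi => ?_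
  · exact pairwise_coprime_X_sub_C (s := fun i : ℕ => (i : ℂ)) Nat.cast_injective hij
  · exact dvd_iff_isRoot.2 (h i (Finset.mem_range.1 hi))

end Divisibility

end PainleveII

open PainleveII in
theorem theorem5 (N : ℕ) (hN : 1 ≤ N) :
    ∃ Q : ℕ → ℂ[X], IsYablonskiiVorobev N Q ∧
      (∀ Q' : ℕ → ℂ[X], IsYablonskiiVorobev N Q' → Q' = Q) ∧
      ∀ l : ℕ, ∃ P : ℂ[X],
        (∀ n : ℕ, (2 * N + 1) * l ≤ (Q n).natDegree →
          coeffA (Q n) ((2 * N + 1) * l) = P.eval (n : ℂ)) ∧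
        P.natDegree = 2 * (N + 1) * l ∧
        polyT (nZero N l) ∣ P := by
  obtain ⟨Q, hQ⟩ := exists_isYablonskiiVorobev hN
  refine ⟨Q, hQ, fun Q' hQ' => hQ.unique hQ', fun l => ?_⟩
  have hcoeff (n : ℕ) : (Q n).reverse.coeff ((2 * N + 1) * l) =
      (newtonCoeff (powerSum N (l + 1)) ((2 * N + 1) * l)).eval (n : ℂ) :=
    hQ.coeff_reverse_eq n (Nat.mul_lt_mul_of_pos_left (by lia) (by lia))
  refine ⟨newtonCoeff (powerSum N (l + 1)) ((2 * N + 1) * l), fun n hn => ?_,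
    natDegree_newtonCoeff_powerSum N l l, polyT_dvd fun n hn => ?_⟩
  · rw [← hcoeff, coeff_reverse, revAt_le hn, coeffA]
  · have hdeg : (Q n).natDegree < (2 * N + 1) * l := by
      have := hQ.natDegree_mul_two n
      have := lt_of_lt_nZero hn
      lia
    rw [← hcoeff, coeff_reverse, revAt_eq_self_of_lt hdeg, coeff_eq_zero_of_natDegree_lt hdeg]
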